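/- Let $b$ be a prime, $\mathbb Z_b=\{0,\dots,b-1\}$ the field with $b$ elements, $d,m\in\mathbb N$ (positive integers) and $t\in\{0,1,\dots,m\}$, with $t<m$ or $d=1$ (and $0^0:=1$). *Digital nets.* Let $C_1,\dots,C_d$ be $m\times m$ matrices over $\mathbb Z_b$ such that for all integers $\ell_1,\dots,\ell_d\ge 0$ with $\ell_1+\cdots+\ell_d=m-t$ the system of the first $\ell_1$ rows of $C_1$, together with the first $\ell_2$ rows of $C_2$, …, together with the first $\ell_d$ rows of $C_d$, is linearly independent over $\mathbb Z_b$. For $n=n_0+n_1b+\cdots+n_{m-1}b^{m-1}\in\{0,\dots,b^m-1\}$ put $C_j(n_0,\dots,n_{m-1})^\top=(y^{(j)}_{1},\dots,y^{(j)}_{m})^\top$, $x_n^{(j)}=\sum_{i=1}^m y_i^{(j)}b^{-i}$ and $\boldsymbol x_n=(x_n^{(1)},\dots,x_n^{(d)})\in[0,1)^d$. Then $\mathcal P=\{\boldsymbol x_0,\dots,\boldsymbol x_{b^m-1}\}$ (points counted with multiplicity) is called a digital $(t,m,d)$-net over $\mathbb Z_b$. *Digital shift of depth $m$.* Choose $\sigma_{j,i}$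 ($1\le j\le d$, $1\le i\le m$) uniformly in $\mathbb Z_b$ and $\delta_{n,j}$ ($0\le n<b^m$, $1\le j\le d$) uniformly in $[0,b^{-m})$, all independent. If $x_n^{(j)}=\sum_{i=1}^m x_{n,i}^{(j)}b^{-i}$ with digits $x_{n,i}^{(j)}\in\mathbb Z_b$, let $z_n^{(j)}=\sum_{i=1}^m z_{n,i}^{(j)}b^{-i}+\delta_{n,j}$ with $z_{n,i}^{(j)}\in\{0,\dots,b-1\}$, $z_{n,i}^{(j)}\equiv x_{n,i}^{(j)}+\sigma_{j,i}\pmod b$. The digitally shifted version of $\mathcal P$ is $\widetilde{\mathcal P}=\{\boldsymbol z_0,\dots,\boldsymbol z_{b^m-1}\}$, where $\boldsymbol z_n=(z_n^{(1)},\dots,z_n^{(d)})$. *Periodic discrepancy.* For $x,y\in[0,1]$ let $I(x,y)=[x,y)$ if $x\le y$ and $I(x,y)=[0,y)\cup[x,1)$ if $x>y$; for $\boldsymbol x,\boldsymbol y\in[0,1]^d$ let $B(\boldsymbol x,\boldsymbol y)=\prod_{j=1}^d I(x_j,y_j)$. The periodic $L_2$ discrepancy of an $N$-point set $\mathcal Q=\{\boldsymbol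 q_0,\dots,\boldsymbol q_{N-1}\}$ in $[0,1)^d$ is $$L_{2,N}^{\rm per}(\mathcal Q)=\left(\int_{[0,1]^d}\int_{[0,1]^d}\bigl|\#\{n:\boldsymbol q_n\in B(\boldsymbol x,\boldsymbol y)\}-N\lambda(B(\boldsymbol x,\boldsymbol y))\bigr|^2\,d\boldsymbol x\,d\boldsymbol y\right)^{1/2},$$ where $\lambda$ is Lebesgue measure. **Theorem.** If $\mathcal P$ is a digital $(t,m,d)$-net over $\mathbb Z_b$ and $\widetilde{\mathcal P}$ is its random digitally shifted (of depth $m$) version, then $(L_{2,b^m}^{\rm per}(\widetilde{\mathcal P}))^2$ is integrable and $$\mathbb E\bigl[(L_{2,b^m}^{\rm per}(\widetilde{\mathcal P}))^2\bigr]\le b^{2t}\,(m-t)^{d-1}\left(\frac{1+b^2}{3}\right)^d .$$ -/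

import Mathlib

namespace PeriodicDiscrepancy

open MeasureTheory ProbabilityTheory

/-- The periodic interval `I(x, y)`: `[x, y)` if `x ≤ y`, and `[0, y) ∪ [x, 1)` if `x > y`. -/
noncomputable def perInterval (x y : ℝ) : Set ℝ :=
  if x ≤ y then Set.Ico x y else Set.Ico 0 y ∪ Set.Ico x 1

/-- The periodic box `B(x, y) = I(x₁, y₁) × ⋯ × I(x_d, y_d)`. -/
noncomputable def perBox {d : ℕ} (x y : Fin d → ℝ) : Set (Fin d → ℝ) :=
  Set.univ.pi fun j => perInterval (x j) (y j)

/-- The counting function: the number of indices `n` with `P n ∈ B`. -/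
noncomputable def count {N d : ℕ} (P : Fin N → Fin d → ℝ) (B : Set (Fin d → ℝ)) : ℕ :=
  {n : Fin N | P n ∈ B}.ncard

/-- The local discrepancy `A(B, P) - N λ(B)`, with `λ` the Lebesgue measure on `ℝ^d`. -/
noncomputable def localDiscrepancy {N d : ℕ} (P : Fin N → Fin d → ℝ) (B : Set (Fin d → ℝ)) : ℝ :=
  (count P B : ℝ) - (N : ℝ) * volume.real B

/-- The periodic `L_p` discrepancy of the point set `P 0, …, P (N - 1)` (counted with
multiplicity). Here `Set.Icc 0 1` is the unit cube `[0,1]^d`. -/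
noncomputable def perLpDiscrepancy (p : ℝ) {N d : ℕ} (P : Fin N → Fin d → ℝ) : ℝ :=
  (∫ x in Set.Icc (0 : Fin d → ℝ) 1, ∫ y in Set.Icc (0 : Fin d → ℝ) 1,
    |localDiscrepancy P (perBox x y)| ^ p) ^ (1 / p)

/-- `C₁, …, C_d` generate a digital `(t, m, d)`-net over `ℤ_b`: `t ≤ m`, and for all
`ℓ₁ + ⋯ + ℓ_d = m - t` the system of the first `ℓ_j` rows of `C_j`, for all `j`,
is linearly independent. -/
def IsGenerating (b t m d : ℕ) (C : Fin d → Matrix (Fin m) (Fin m) (ZMod b)) : Prop :=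
  t ≤ m ∧ ∀ ℓ : Fin d → ℕ, (∑ j, ℓ j) + t = m →
    LinearIndependent (ZMod b)
      (fun p : {p : Fin d × Fin m // (p.2 : ℕ) < ℓ p.1} => (C p.1.1 p.1.2 : Fin m → ZMod b))

/-- The vector `(n₀, …, n_{m-1})` of base `b` digits of `n`, least significant digit first. -/
def digitVec (b m n : ℕ) : Fin m → ZMod b :=
  fun i => ((n / b ^ (i : ℕ) % b : ℕ) : ZMod b)

/-- The number `y₁ / b + ⋯ + y_m / b^m`, where `ℤ_b` is identified with `{0, …, b - 1}`. -/
noncomputable def ofDigits {b m : ℕ} (y : Fin m → ZMod b) : ℝ :=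
  ∑ i : Fin m, ((y i).val : ℝ) / (b : ℝ) ^ ((i : ℕ) + 1)

/-- The points generated by the matrices `C₁, …, C_d`. -/
noncomputable def netPoint {b m d : ℕ} (C : Fin d → Matrix (Fin m) (Fin m) (ZMod b)) :
    Fin (b ^ m) → Fin d → ℝ :=
  fun n j => ofDigits ((C j).mulVec (digitVec b m n))

/-- `P` is a digital `(t, m, d)`-net over `ℤ_b`. -/
def IsDigitalNet (b t m d : ℕ) (P : Fin (b ^ m) → Fin d → ℝ) : Prop :=
  ∃ C : Fin d → Matrix (Fin m) (Fin m) (ZMod b), IsGenerating b t m d C ∧ P = netPoint C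

/-- The first `m` digits after the point in the base `b` expansion of `x ∈ [0, 1)`
(the index `i` stands for the digit belonging to `b ^ (-(i + 1))`). -/
noncomputable def expansion (b m : ℕ) (x : ℝ) : Fin m → ZMod b :=
  fun i => ((⌊x * (b : ℝ) ^ ((i : ℕ) + 1)⌋ : ℤ) : ZMod b)

/-- The digital shift of depth `m`, by the digits `σ j i` and the numbers `δ n j`: in
coordinate `j`, the digits `σ j 0, …, σ j (m - 1)` are added modulo `b` to the first `m` digits
of every point, and then `δ n j` is added to the `n`-th point. -/
noncomputable def digitalShift {b m d N : ℕ} (σ : Fin d → Fin m → ZMod b)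
    (δ : Fin N → Fin d → ℝ) (P : Fin N → Fin d → ℝ) : Fin N → Fin d → ℝ :=
  fun n j => ofDigits (fun i => expansion b m (P n j) i + σ j i) + δ n j

/-- The law of a random digital shift of depth `m` for `N` points in dimension `d`: all the
digits `σ j i` are uniform on `ℤ_b`, all the `δ n j` are uniform on `[0, b ^ (-m))`, and all of
them are independent. -/
noncomputable def shiftLaw (b m d N : ℕ) :
    Measure ((Fin d → Fin m → ZMod b) × (Fin N → Fin d → ℝ)) :=
  (Measure.pi fun _ : Fin d => Measure.pi fun _ : Fin m =>
      (uniformOn (Set.univ : Set (ZMod b)) : Measure (ZMod b))).prod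
    (Measure.pi fun _ : Fin N => Measure.pi fun _ : Fin d =>
      (cond volume (Set.Ico (0 : ℝ) (1 / (b : ℝ) ^ m)) : Measure ℝ))

end PeriodicDiscrepancy

namespace PeriodicDiscrepancy

open MeasureTheory ProbabilityTheory

/-! ### Base `b` digits and averages over a common digital shift -/

section Digits

variable {b m : ℕ}

/-! Expanding the square in the discrepancy gives a pair sum: with K(u) = 1/2 - |u| + u², the
squared discrepancy is the sum over n, p of ∏_j K(x_n^(j) - x_p^(j)), minus N²/3^d
(`perLpDiscrepancy_two_sq`). For n ≠ p the expectation factors over the coordinates and turns K into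
`shiftKernel`, which depends only on the digitwise difference (`shiftKernel_sub`). The digits of a
net point are linear in the digits of its index, so the double sum collapses to b^m times one sum
over a vector v. The diagonal terms carry K(0) = 1/2 instead of the averaged kernel; this costs at
most 1/3 in all (`diagonal_le`).

The averaged kernel is now expanded in characters of the group of digit vectors (Walsh functions).
Orthogonality turns the sum over v into a sum over the dual net (`sum_prod_shiftKernel`), whose zero
frequency contributes exactly N²/3^d and cancels. A coefficient at a frequency with a > 0 digits is
at most (b²/4 - 1/3) b^(-2a) (`abs_kernelCoeff_le`). The net property makes the levels of a nonzero
dual vector add up to more than m - t (`sum_level_gt_of_mem_dualNet`), and leaves at most b^(∑ a_j -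
(m - t)) dual vectors with prescribed levels a_j (`card_dualNet_level_le`).

What remains is a geometric sum over level vectors of total more than M = m - t, which is of order
M^(d-1) b^(-M) (`tailSum_le`). After multiplication by b^(2m) it is at most 3/5 of the claimed
bound. That bound is at least 5/3, so the other 2/5 absorbs the diagonal error. -/

lemma ofDigits_cons (a : ZMod b) (y : Fin m → ZMod b) :
    ofDigits (Fin.cons a y : Fin (m + 1) → ZMod b) = ((a.val : ℝ) + ofDigits y) / b := by
  simp only [ofDigits, Fin.sum_univ_succ, Fin.cons_zero, Fin.cons_succ, Fin.val_zero, Fin.val_succ,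
    add_div, Finset.sum_div, zero_add, pow_one]
  congr 1
  refine Finset.sum_congr rfl fun i _ => ?_
  rw [div_div, ← pow_succ]

lemma ofDigits_nonneg (y : Fin m → ZMod b) : 0 ≤ ofDigits y :=
  Finset.sum_nonneg fun _ _ => by positivity

lemma ofDigits_add_le [NeZero b] (y : Fin m → ZMod b) : ofDigits y + 1 / (b : ℝ) ^ m ≤ 1 := by
  have hb : (0 : ℝ) < b := by exact_mod_cast Nat.pos_of_ne_zero (NeZero.ne b)
  induction m with
  | zero => simp [ofDigits]
  | succ m ih =>
    rw [← Fin.cons_self_tail y, ofDigits_cons]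
    have h1 : ((y 0).val : ℝ) + 1 ≤ b := by exact_mod_cast ZMod.val_lt (y 0)
    have h2 := ih (Fin.tail y)
    have : (1 : ℝ) / b ^ (m + 1) = (1 / b ^ m) / b := by rw [pow_succ, div_div]
    rw [this, ← add_div, div_le_one hb]
    linarith

lemma ofDigits_lt_one [NeZero b] (y : Fin m → ZMod b) : ofDigits y < 1 := by
  have hb : (0 : ℝ) < b := by exact_mod_cast Nat.pos_of_ne_zero (NeZero.ne b)
  have := ofDigits_add_le y
  have h : (0 : ℝ) < 1 / (b : ℝ) ^ m := by positivity
  linarith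

lemma expansion_ofDigits [NeZero b] (y : Fin m → ZMod b) : expansion b m (ofDigits y) = y := by
  have hb : (0 : ℝ) < b := by exact_mod_cast Nat.pos_of_ne_zero (NeZero.ne b)
  induction m with
  | zero => exact Subsingleton.elim _ _
  | succ m ih =>
    rw [← Fin.cons_self_tail y, ofDigits_cons]
    set a := y 0
    set w := Fin.tail y
    have hfl : ⌊(a.val : ℝ) + ofDigits w⌋ = (a.val : ℤ) := by
      rw [Int.floor_eq_iff]
      push_cast
      exact ⟨by linarith [ofDigits_nonneg w], by linarith [ofDigits_lt_one w]⟩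
    funext i
    refine Fin.cases ?_ (fun i => ?_) i
    · simp only [expansion, Fin.val_zero, zero_add, pow_one, Fin.cons_zero]
      rw [div_mul_cancel₀ _ hb.ne', hfl]
      simp
    · simp only [Fin.cons_succ, expansion, Fin.val_succ]
      have hi := congrFun (ih w) i
      simp only [expansion] at hi
      have : ((a.val : ℝ) + ofDigits w) / b * (b : ℝ) ^ ((i : ℕ) + 1 + 1)
          = ofDigits w * (b : ℝ) ^ ((i : ℕ) + 1) + ((a.val * b ^ ((i : ℕ) + 1) : ℕ) : ℝ) := by
        push_cast
        field_simp
        ring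
      rw [this, Int.floor_add_natCast]
      push_cast
      rw [hi]
      simp

lemma one_le_abs_val_sub [NeZero b] {x y : ZMod b} (h : x ≠ y) :
    1 ≤ |(x.val : ℝ) - (y.val : ℝ)| := by
  have h1 : (x.val : ℤ) - y.val ≠ 0 := by
    intro h0
    exact h (ZMod.val_injective b (by omega))
  exact_mod_cast Int.one_le_abs h1

/-- At the first digit where the vectors differ the gap is at least one unit, and the later digits
recover at most that unit minus one unit of the last place. This separation later fixes the sign of
a difference of two shifted points. -/
lemma ofDigits_sub_abs_ge [NeZero b] {x y : Fin m → ZMod b} (h : x ≠ y) :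
    1 / (b : ℝ) ^ m ≤ |ofDigits x - ofDigits y| := by
  have hb : (0 : ℝ) < b := by exact_mod_cast Nat.pos_of_ne_zero (NeZero.ne b)
  induction m with
  | zero => exact absurd (Subsingleton.elim _ _) h
  | succ m ih =>
    rw [← Fin.cons_self_tail x, ← Fin.cons_self_tail y, ofDigits_cons, ofDigits_cons, ← sub_div,
      abs_div, abs_of_pos hb, pow_succ, ← div_div, div_le_div_iff_of_pos_right hb]
    by_cases h0 : x 0 = y 0
    · have ht : Fin.tail x ≠ Fin.tail y := by
        intro ht
        apply h
        rw [← Fin.cons_self_tail x, ← Fin.cons_self_tail y, h0, ht]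
      have := ih ht
      rw [h0]
      simpa using this
    · have h1 := one_le_abs_val_sub h0
      have hx := ofDigits_nonneg (Fin.tail x)
      have hy := ofDigits_nonneg (Fin.tail y)
      have hx' := ofDigits_add_le (Fin.tail x)
      have hy' := ofDigits_add_le (Fin.tail y)
      rcases le_abs.1 h1 with h2 | h2
      · exact le_abs.2 (Or.inl (by linarith))
      · exact le_abs.2 (Or.inr (by linarith))

/-- The quadratic form `h (b - h)` in the representative `0 ≤ h < b` of a digit. -/
noncomputable def digitForm (h : ZMod b) : ℝ := (h.val : ℝ) * ((b : ℝ) - h.val)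

@[simp] lemma digitForm_zero : digitForm (0 : ZMod b) = 0 := by simp [digitForm]

lemma sum_zmod_val [NeZero b] {M : Type*} [AddCommMonoid M] (F : ℕ → M) :
    ∑ s : ZMod b, F s.val = ∑ i ∈ Finset.range b, F i := by
  obtain ⟨n, rfl⟩ := Nat.exists_eq_succ_of_ne_zero (NeZero.ne b)
  exact Fin.sum_univ_eq_sum_range F (n + 1)

/-- Only wrap-around changes the integer difference. With h the representative of x - y, exactly b -
h of the shifts give the difference h and the other h shifts give h - b. -/
lemma sum_digit_diff [NeZero b] (g : ℝ → ℝ) (x y : ZMod b) :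
    ∑ s : ZMod b, g (((x + s).val : ℝ) - ((y + s).val : ℝ))
      = ((b : ℝ) - (x - y).val) * g ((x - y).val) + (x - y).val * g ((x - y).val - b) := by
  set h := x - y with hh
  have h1 : ∑ s : ZMod b, g (((x + s).val : ℝ) - ((y + s).val : ℝ))
      = ∑ s : ZMod b, g (((h + s).val : ℝ) - (s.val : ℝ)) := by
    refine Fintype.sum_equiv (Equiv.addLeft y) _ _ fun s => ?_
    simp only [Equiv.coe_addLeft]
    rw [hh, show x - y + (y + s) = x + s by ring]
  have h2 : ∀ s : ZMod b, g (((h + s).val : ℝ) - (s.val : ℝ))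
      = (fun i : ℕ => if i < b - h.val then g h.val else g (h.val - b)) s.val := by
    intro s
    have hs := ZMod.val_lt s
    have hlt := ZMod.val_lt h
    simp only []
    split_ifs with hc
    · rw [ZMod.val_add_of_lt (by omega)]
      push_cast
      congr 1
      ring
    · have := ZMod.val_add_val_of_le (a := h) (b := s) (by omega)
      have h3 : ((h + s).val : ℝ) = h.val + s.val - b := by
        rw [eq_sub_iff_add_eq]
        exact_mod_cast this.symm
      rw [h3]
      congr 1
      ring
  rw [h1, Finset.sum_congr rfl fun s _ => h2 s,
    sum_zmod_val (fun i : ℕ => if i < b - h.val then g h.val else g (h.val - b))]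
  have hlt := ZMod.val_lt h
  rw [Finset.sum_ite, Finset.sum_const, Finset.sum_const]
  have c1 : (Finset.filter (fun i => i < b - h.val) (Finset.range b)).card = b - h.val := by
    rw [show Finset.filter (fun i => i < b - h.val) (Finset.range b) = Finset.range (b - h.val) by
      ext i; simp; omega, Finset.card_range]
  have c2 : (Finset.filter (fun i => ¬ i < b - h.val) (Finset.range b)).card = h.val := by
    rw [show Finset.filter (fun i => ¬ i < b - h.val) (Finset.range b) = Finset.Ico (b - h.val) b by
      ext i; simp; omega, Nat.card_Ico]
    omega
  rw [c1, c2, nsmul_eq_mul, nsmul_eq_mul, Nat.cast_sub hlt.le]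

lemma sum_digit_diff_abs [NeZero b] (x y : ZMod b) :
    ∑ s : ZMod b, |((x + s).val : ℝ) - ((y + s).val : ℝ)| = 2 * digitForm (x - y) := by
  rw [sum_digit_diff (fun u => |u|) x y]
  have hlt : ((x - y).val : ℝ) < b := by exact_mod_cast ZMod.val_lt (x - y)
  rw [abs_of_nonneg (by positivity), abs_of_neg (by linarith), digitForm]
  ring

lemma sum_digit_diff_sq [NeZero b] (x y : ZMod b) :
    ∑ s : ZMod b, (((x + s).val : ℝ) - ((y + s).val : ℝ)) ^ 2 = b * digitForm (x - y) := by
  rw [sum_digit_diff (fun u => u ^ 2) x y, digitForm]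
  ring

lemma sum_fin_cons [NeZero b] {M : Type*} [AddCommMonoid M] (F : (Fin (m + 1) → ZMod b) → M) :
    ∑ s, F s = ∑ s0 : ZMod b, ∑ s' : Fin m → ZMod b, F (Fin.cons s0 s') := by
  rw [← Fintype.sum_prod_type' (f := fun s0 s' => F (Fin.cons s0 s'))]
  exact (Fintype.sum_equiv (Fin.consEquiv fun _ : Fin (m + 1) => ZMod b) _ _ fun _ => rfl).symm

lemma cons_add_cons (x s : ZMod b) (x' s' : Fin m → ZMod b) :
    (Fin.cons x x' : Fin (m + 1) → ZMod b) + Fin.cons s s' = Fin.cons (x + s) (x' + s') := by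
  funext i
  refine Fin.cases ?_ (fun i => ?_) i <;> simp

lemma sum_ofDigits_shift_diff [NeZero b] (x y : Fin m → ZMod b) :
    ∑ s : Fin m → ZMod b, (ofDigits (x + s) - ofDigits (y + s)) = 0 := by
  rw [Finset.sum_sub_distrib, sub_eq_zero]
  trans ∑ s : Fin m → ZMod b, ofDigits s
  · exact Fintype.sum_equiv (Equiv.addLeft x) _ _ fun s => rfl
  · exact (Fintype.sum_equiv (Equiv.addLeft y) _ _ fun s => rfl).symm

/-- The mean distance of two shifted points with digits `x` and `y`. -/
noncomputable def absMean (x y : Fin m → ZMod b) [NeZero b] : ℝ :=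
  ((b : ℝ) ^ m)⁻¹ * ∑ s : Fin m → ZMod b,
    (if x = y then 1 / (3 * (b : ℝ) ^ m) else |ofDigits (x + s) - ofDigits (y + s)|)

/-- The mean squared distance of two shifted points with digits `x` and `y`. -/
noncomputable def sqMean (x y : Fin m → ZMod b) [NeZero b] : ℝ :=
  ((b : ℝ) ^ m)⁻¹ * (∑ s : Fin m → ZMod b, (ofDigits (x + s) - ofDigits (y + s)) ^ 2)
    + 1 / (6 * ((b : ℝ) ^ m) ^ 2)

lemma absMean_zero [NeZero b] (x y : Fin 0 → ZMod b) : absMean x y = 1 / 3 := by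
  simp [absMean, Subsingleton.elim x y]

lemma sqMean_zero [NeZero b] (x y : Fin 0 → ZMod b) : sqMean x y = 1 / 6 := by
  simp [sqMean, Subsingleton.elim x y]

/-- Two tails differ by less than 1 ≤ |u|, so the sign of u decides the absolute value; the tail
differences then enter linearly and cancel in the sum. -/
lemma sum_abs_add_ofDigits [NeZero b] (u : ℝ) (hu : 1 ≤ |u|) (x y : Fin m → ZMod b) :
    ∑ s : Fin m → ZMod b, |u + (ofDigits (x + s) - ofDigits (y + s))| = (b : ℝ) ^ m * |u| := by
  have key : ∀ s : Fin m → ZMod b, |u + (ofDigits (x + s) - ofDigits (y + s))|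
      = |u| + (if 0 ≤ u then 1 else -1) * (ofDigits (x + s) - ofDigits (y + s)) := by
    intro s
    have hx := ofDigits_nonneg (x + s)
    have hy := ofDigits_nonneg (y + s)
    have hx' := ofDigits_lt_one (x + s)
    have hy' := ofDigits_lt_one (y + s)
    split_ifs with h
    · rw [abs_of_nonneg h] at hu ⊢
      rw [abs_of_nonneg (by linarith)]
      ring
    · rw [abs_of_neg (not_le.1 h)] at hu ⊢
      rw [abs_of_neg (by linarith)]
      ring
  rw [Finset.sum_congr rfl fun s _ => key s, Finset.sum_add_distrib, ← Finset.mul_sum,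
    sum_ofDigits_shift_diff]
  simp [ZMod.card]

/-- Equal leading digits leave the tail problem scaled by 1/b. Unequal ones hide the tails
completely, and the mean is that of the leading digits alone. -/
lemma absMean_cons [NeZero b] (x0 y0 : ZMod b) (x y : Fin m → ZMod b) :
    absMean (Fin.cons x0 x : Fin (m + 1) → ZMod b) (Fin.cons y0 y)
      = (if x0 = y0 then absMean x y else 0) / b + 2 * digitForm (x0 - y0) / (b : ℝ) ^ 2 := by
  have hb : (0 : ℝ) < b := by exact_mod_cast Nat.pos_of_ne_zero (NeZero.ne b)
  rw [absMean, sum_fin_cons]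
  simp only [cons_add_cons, ofDigits_cons]
  by_cases h : x0 = y0
  · subst h
    have : ∀ s : ZMod b, ∀ s' : Fin m → ZMod b,
        (if (Fin.cons x0 x : Fin (m + 1) → ZMod b) = Fin.cons x0 y then 1 / (3 * (b : ℝ) ^ (m + 1))
          else |(((x0 + s).val : ℝ) + ofDigits (x + s')) / b
            - (((x0 + s).val : ℝ) + ofDigits (y + s')) / b|)
        = (if x = y then 1 / (3 * (b : ℝ) ^ m) else |ofDigits (x + s') - ofDigits (y + s')|) / b := by
      intro s s'
      have : (Fin.cons x0 x : Fin (m + 1) → ZMod b) = Fin.cons x0 y ↔ x = y :=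
        ⟨fun h => Fin.cons_right_injective _ h, fun h => by rw [h]⟩
      simp only [this]
      split_ifs
      · rw [pow_succ]; field_simp
      · rw [← sub_div, abs_div, abs_of_pos hb, add_sub_add_left_eq_sub]
    simp only [this, ← Finset.sum_div, Finset.sum_const, Finset.card_univ, ZMod.card, if_true,
      sub_self, digitForm_zero, absMean, nsmul_eq_mul]
    rw [pow_succ]
    field_simp
    ring
  · have hne : (Fin.cons x0 x : Fin (m + 1) → ZMod b) ≠ Fin.cons y0 y := by
      intro he
      exact h (by simpa using congrFun he 0)
    simp only [if_neg hne, if_neg h]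
    have : ∀ s : ZMod b, ∀ s' : Fin m → ZMod b,
        |(((x0 + s).val : ℝ) + ofDigits (x + s')) / b - (((y0 + s).val : ℝ) + ofDigits (y + s')) / b|
        = |(((x0 + s).val : ℝ) - ((y0 + s).val : ℝ))
            + (ofDigits (x + s') - ofDigits (y + s'))| / b := by
      intro s s'
      rw [← sub_div, abs_div, abs_of_pos hb]
      congr 2
      ring
    simp only [this, ← Finset.sum_div]
    rw [Finset.sum_congr rfl fun s _ =>
      sum_abs_add_ofDigits _ (one_le_abs_val_sub (b := b) (fun he => h (add_right_cancel he))) x y,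
      ← Finset.mul_sum, sum_digit_diff_abs, pow_succ]
    field_simp
    ring

/-- The cross term between leading digit and tail averages to zero, so the two contributions simply
add. -/
lemma sqMean_cons [NeZero b] (x0 y0 : ZMod b) (x y : Fin m → ZMod b) :
    sqMean (Fin.cons x0 x : Fin (m + 1) → ZMod b) (Fin.cons y0 y)
      = (digitForm (x0 - y0) + sqMean x y) / (b : ℝ) ^ 2 := by
  have hb : (0 : ℝ) < b := by exact_mod_cast Nat.pos_of_ne_zero (NeZero.ne b)
  rw [sqMean, sum_fin_cons]
  simp only [cons_add_cons, ofDigits_cons]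
  have : ∀ s : ZMod b, ∀ s' : Fin m → ZMod b,
      ((((x0 + s).val : ℝ) + ofDigits (x + s')) / b
        - (((y0 + s).val : ℝ) + ofDigits (y + s')) / b) ^ 2
      = ((((x0 + s).val : ℝ) - ((y0 + s).val : ℝ)) ^ 2
        + (2 * (((x0 + s).val : ℝ) - ((y0 + s).val : ℝ))) * (ofDigits (x + s') - ofDigits (y + s'))
        + (ofDigits (x + s') - ofDigits (y + s')) ^ 2) / (b : ℝ) ^ 2 := by
    intro s s'
    field_simp
    ring
  simp only [this, ← Finset.sum_div, Finset.sum_add_distrib, ← Finset.mul_sum,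
    sum_ofDigits_shift_diff, Finset.sum_const, Finset.card_univ, Fintype.card_fun, ZMod.card,
    Fintype.card_fin, mul_zero, add_zero, nsmul_eq_mul, sum_digit_diff_sq, sqMean]
  rw [pow_succ]
  push_cast
  field_simp
  ring

end Digits

/-! ### Fourier transform of the digit form on `ZMod b` -/

section Fourier

variable {b m : ℕ} [NeZero b]

lemma sum_stdAddChar_mul (h : ZMod b) :
    ∑ κ : ZMod b, (ZMod.stdAddChar (κ * h) : ℂ) = if h = 0 then (b : ℂ) else 0 := by
  rw [AddChar.sum_mulShift h (ZMod.isPrimitive_stdAddChar b), ZMod.card]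
  split_ifs <;> simp

lemma digitForm_natCast {n : ℕ} (hn : n ≤ b) :
    digitForm (n : ZMod b) = (n : ℝ) * ((b : ℝ) - n) := by
  rcases hn.lt_or_eq with h | h
  · rw [digitForm, ZMod.val_natCast_of_lt h]
  · subst h
    simp

/-- A quadratic has constant second difference; the kink of the periodic extension at 0 adds a point
mass. Both have trivial Fourier transforms. -/
lemma digitForm_second_diff (h : ZMod b) :
    2 * digitForm h - digitForm (h + 1) - digitForm (h - 1) = 2 - if h = 0 then 2 * (b : ℝ) else 0 := by
  have hb : 1 ≤ b := Nat.one_le_iff_ne_zero.2 (NeZero.ne b)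
  have hv := ZMod.val_lt h
  have e1 : digitForm (h + 1) = ((h.val : ℝ) + 1) * ((b : ℝ) - (h.val + 1)) := by
    have := digitForm_natCast (b := b) (n := h.val + 1) (by omega)
    push_cast at this
    rwa [ZMod.natCast_zmod_val] at this
  rw [e1]
  split_ifs with h0
  · subst h0
    have e2 : digitForm ((0 : ZMod b) - 1) = ((b : ℝ) - 1) := by
      have := digitForm_natCast (b := b) (n := b - 1) (by omega)
      rw [Nat.cast_sub hb, Nat.cast_sub hb] at this
      simp only [CharP.cast_eq_zero, Nat.cast_one] at this
      rw [this]
      ring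
    rw [e2]
    simp
    ring
  · have hv0 : 1 ≤ h.val := Nat.one_le_iff_ne_zero.2 (by simpa using h0)
    have e2 : digitForm (h - 1) = ((h.val : ℝ) - 1) * ((b : ℝ) - (h.val - 1)) := by
      have := digitForm_natCast (b := b) (n := h.val - 1) (by omega)
      rw [Nat.cast_sub hv0, Nat.cast_sub hv0] at this
      rwa [ZMod.natCast_zmod_val, Nat.cast_one, Nat.cast_one] at this
    rw [e2, digitForm]
    ring

lemma sum_digitForm : ∑ h : ZMod b, digitForm h = (b : ℝ) * ((b : ℝ) ^ 2 - 1) / 6 := by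
  simp only [digitForm]
  rw [sum_zmod_val (fun i : ℕ => (i : ℝ) * ((b : ℝ) - i))]
  have key : ∀ (c : ℝ) (n : ℕ), ∑ i ∈ Finset.range n, (i : ℝ) * (c - i)
      = c * (n * (n - 1)) / 2 - (n - 1) * n * (2 * n - 1) / 6 := by
    intro c n
    induction n with
    | zero => simp
    | succ n ih =>
      rw [Finset.sum_range_succ, ih]
      push_cast
      ring
  rw [key]
  ring

/-- Minus the Fourier coefficient of `digitForm` at a nonzero frequency. -/
noncomputable def digitSine (κ : ZMod b) : ℝ :=
  2 / Complex.normSq (1 - (ZMod.stdAddChar κ : ℂ))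

/-- The Fourier coefficients of `digitForm`. -/
noncomputable def digitCoeff (κ : ZMod b) : ℝ :=
  if κ = 0 then ((b : ℝ) ^ 2 - 1) / 6 else -digitSine κ

lemma normSq_one_sub_stdAddChar (κ : ZMod b) :
    (Complex.normSq (1 - (ZMod.stdAddChar κ : ℂ)) : ℂ)
      = 2 - ZMod.stdAddChar κ - ZMod.stdAddChar (-κ) := by
  rw [← Complex.mul_conj, map_sub, map_one, ← AddChar.map_neg_eq_conj]
  have : (ZMod.stdAddChar κ : ℂ) * ZMod.stdAddChar (-κ) = 1 := by
    rw [← AddChar.map_add_eq_mul, add_neg_cancel, AddChar.map_zero_eq_one]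
  linear_combination this

lemma stdAddChar_ne_one {κ : ZMod b} (h : κ ≠ 0) : (ZMod.stdAddChar κ : ℂ) ≠ 1 := by
  intro h1
  apply h
  apply ZMod.injective_stdAddChar
  rw [h1, AddChar.map_zero_eq_one]

lemma sum_digitForm_mul_stdAddChar (κ : ZMod b) :
    ∑ h : ZMod b, (digitForm h : ℂ) * ZMod.stdAddChar (-(κ * h)) = b * digitCoeff κ := by
  have hb : (b : ℂ) ≠ 0 := by exact_mod_cast NeZero.ne b
  rw [digitCoeff]
  split_ifs with h0
  · subst h0
    simp only [zero_mul, neg_zero, AddChar.map_zero_eq_one, mul_one]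
    rw [← Complex.ofReal_sum, sum_digitForm]
    push_cast
    ring
  · set E : ℝ := Complex.normSq (1 - (ZMod.stdAddChar κ : ℂ)) with hE
    have hE0 : (E : ℂ) ≠ 0 := by
      rw [hE, Complex.ofReal_ne_zero]
      simpa [sub_eq_zero] using (stdAddChar_ne_one h0).symm
    -- Multiplication by |1 - χ(κ)|² = 2 - χ(κ) - χ(-κ) is a second difference after translating the
    -- summation variable. For κ ≠ 0 the constant part disappears and the point mass leaves -2b.
    have key : (∑ h : ZMod b, (digitForm h : ℂ) * ZMod.stdAddChar (-(κ * h))) * E = -2 * b := by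
      rw [hE, normSq_one_sub_stdAddChar, Finset.sum_mul]
      have e1 : ∑ h : ZMod b, (digitForm h : ℂ) * ZMod.stdAddChar (-(κ * (h - 1)))
          = ∑ h : ZMod b, (digitForm (h + 1) : ℂ) * ZMod.stdAddChar (-(κ * h)) :=
        (Fintype.sum_equiv (Equiv.addRight (1 : ZMod b)) _ _ fun h => by simp).symm
      have e2 : ∑ h : ZMod b, (digitForm h : ℂ) * ZMod.stdAddChar (-(κ * (h + 1)))
          = ∑ h : ZMod b, (digitForm (h - 1) : ℂ) * ZMod.stdAddChar (-(κ * h)) :=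
        Fintype.sum_equiv (Equiv.addRight (1 : ZMod b)) _ _ fun h => by simp
      have e3 : ∑ h : ZMod b, (digitForm h : ℂ) * ZMod.stdAddChar (-(κ * h))
            * (2 - ZMod.stdAddChar κ - ZMod.stdAddChar (-κ))
          = 2 * ∑ h : ZMod b, (digitForm h : ℂ) * ZMod.stdAddChar (-(κ * h))
            - ∑ h : ZMod b, (digitForm h : ℂ) * ZMod.stdAddChar (-(κ * (h - 1)))
            - ∑ h : ZMod b, (digitForm h : ℂ) * ZMod.stdAddChar (-(κ * (h + 1))) := by
        rw [Finset.mul_sum, ← Finset.sum_sub_distrib, ← Finset.sum_sub_distrib]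
        refine Finset.sum_congr rfl fun h _ => ?_
        rw [show -(κ * (h - 1)) = -(κ * h) + κ by ring, show -(κ * (h + 1)) = -(κ * h) + -κ by ring,
          AddChar.map_add_eq_mul, AddChar.map_add_eq_mul]
        ring
      rw [e3, e1, e2, Finset.mul_sum, ← Finset.sum_sub_distrib, ← Finset.sum_sub_distrib]
      have e4 : ∀ h : ZMod b, 2 * ((digitForm h : ℂ) * ZMod.stdAddChar (-(κ * h)))
            - (digitForm (h + 1) : ℂ) * ZMod.stdAddChar (-(κ * h))
            - (digitForm (h - 1) : ℂ) * ZMod.stdAddChar (-(κ * h))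
          = 2 * ZMod.stdAddChar (h * (-κ)) - if h = 0 then 2 * (b : ℂ) else 0 := by
        intro h
        have := congrArg (fun r : ℝ => (r : ℂ)) (digitForm_second_diff h)
        rw [show h * (-κ) = -(κ * h) by ring]
        by_cases hh : h = 0
        · subst hh
          simp only [if_true, mul_zero, neg_zero, AddChar.map_zero_eq_one, mul_one] at this ⊢
          push_cast at this
          linear_combination this
        · simp only [if_neg hh, sub_zero] at this ⊢
          push_cast at this
          linear_combination this * ZMod.stdAddChar (-(κ * h))
      rw [Finset.sum_congr rfl fun h _ => e4 h, Finset.sum_sub_distrib, ← Finset.mul_sum,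
        sum_stdAddChar_mul, if_neg (by simpa using h0), Finset.sum_ite_eq' Finset.univ (0 : ZMod b)]
      simp
    rw [digitSine, ← hE]
    push_cast
    field_simp
    linear_combination key

lemma digitForm_eq_sum (h : ZMod b) :
    (digitForm h : ℂ) = ∑ κ : ZMod b, (digitCoeff κ : ℂ) * ZMod.stdAddChar (κ * h) := by
  have hb : (b : ℂ) ≠ 0 := by exact_mod_cast NeZero.ne b
  apply mul_left_cancel₀ hb
  rw [Finset.mul_sum]
  simp only [← mul_assoc, ← sum_digitForm_mul_stdAddChar, Finset.sum_mul]
  rw [Finset.sum_comm]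
  have : ∀ g κ : ZMod b, (digitForm g : ℂ) * ZMod.stdAddChar (-(κ * g)) * ZMod.stdAddChar (κ * h)
      = digitForm g * ZMod.stdAddChar (κ * (h - g)) := by
    intro g κ
    rw [mul_assoc, ← AddChar.map_add_eq_mul]
    congr 2
    ring
  simp only [this, ← Finset.mul_sum, sum_stdAddChar_mul, sub_eq_zero, mul_ite, mul_zero]
  rw [Finset.sum_ite_eq Finset.univ h]
  simp [mul_comm]

lemma half_le_digitSine {κ : ZMod b} (h : κ ≠ 0) : 1 / 2 ≤ digitSine κ := by
  have h0 : 0 < Complex.normSq (1 - (ZMod.stdAddChar κ : ℂ)) := by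
    rw [Complex.normSq_pos]
    simpa [sub_eq_zero] using (stdAddChar_ne_one h).symm
  have h1 : Complex.normSq (1 - (ZMod.stdAddChar κ : ℂ)) ≤ 4 := by
    rw [Complex.normSq_eq_norm_sq]
    have : ‖1 - (ZMod.stdAddChar κ : ℂ)‖ ≤ 2 := by
      refine (norm_sub_le _ _).trans ?_
      rw [norm_one, AddChar.norm_apply]
      norm_num
    nlinarith [norm_nonneg (1 - (ZMod.stdAddChar κ : ℂ))]
  rw [digitSine, div_le_div_iff₀ (by norm_num) h0]
  linarith

/-- The norm is 2 sin(πn/b), and Jordan's inequality bounds it below by 4n/b when 1 ≤ n ≤ b/2.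
Either κ or -κ has such a representative, and conjugation keeps the norm. -/
lemma four_div_le_norm_one_sub_stdAddChar {κ : ZMod b} (h : κ ≠ 0) :
    4 / (b : ℝ) ≤ ‖1 - (ZMod.stdAddChar κ : ℂ)‖ := by
  have hb : (0 : ℝ) < b := by exact_mod_cast Nat.pos_of_ne_zero (NeZero.ne b)
  have key : ∀ n : ℕ, 1 ≤ n → 2 * n ≤ b →
      4 / (b : ℝ) ≤ ‖1 - (ZMod.stdAddChar ((n : ℤ) : ZMod b) : ℂ)‖ := by
    intro n h1 h2
    have h1' : (1 : ℝ) ≤ n := by exact_mod_cast h1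
    have h2' : 2 * (n : ℝ) ≤ b := by exact_mod_cast h2
    rw [ZMod.stdAddChar_coe, norm_sub_rev, show (2 * (Real.pi : ℂ) * Complex.I * ((n : ℤ) : ℂ) / b)
      = Complex.I * ((2 * Real.pi * n / b : ℝ) : ℂ) by push_cast; ring,
      Complex.norm_exp_I_mul_ofReal_sub_one]
    refine le_trans ?_ (Real.le_norm_self _)
    have hpi := Real.pi_pos
    have := Real.mul_le_sin (x := 2 * Real.pi * n / b / 2) (by positivity) (by
      rw [div_le_div_iff_of_pos_right (by norm_num), div_le_iff₀ hb]
      nlinarith)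
    have e : 2 / Real.pi * (2 * Real.pi * n / b / 2) = 2 * n / b := by
      field_simp
    rw [e] at this
    have : 2 / (b : ℝ) ≤ 2 * n / b := by
      rw [div_le_div_iff_of_pos_right hb]
      linarith
    have e4 : 4 / (b : ℝ) = 2 * (2 / b) := by ring
    rw [e4]
    linarith
  have hv : 1 ≤ κ.val := Nat.one_le_iff_ne_zero.2 (by simpa using h)
  have hlt := ZMod.val_lt κ
  rcases le_total (2 * κ.val) b with h2 | h2
  · have := key κ.val hv h2
    simpa using this
  · have := key (b - κ.val) (by omega) (by omega)
    have e : (((b - κ.val : ℕ) : ℤ) : ZMod b) = -κ := by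
      push_cast [hlt.le]
      simp
    rw [e, AddChar.map_neg_eq_conj] at this
    rwa [← Complex.norm_conj, map_sub, map_one]

lemma digitSine_le {κ : ZMod b} (h : κ ≠ 0) : digitSine κ ≤ (b : ℝ) ^ 2 / 8 := by
  have hb : (0 : ℝ) < b := by exact_mod_cast Nat.pos_of_ne_zero (NeZero.ne b)
  have h1 := four_div_le_norm_one_sub_stdAddChar h
  have h2 : 16 / (b : ℝ) ^ 2 ≤ Complex.normSq (1 - (ZMod.stdAddChar κ : ℂ)) := by
    rw [Complex.normSq_eq_norm_sq, show (16 : ℝ) / b ^ 2 = (4 / b) ^ 2 by ring]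
    exact pow_le_pow_left₀ (by positivity) h1 2
  rw [digitSine]
  calc 2 / Complex.normSq (1 - (ZMod.stdAddChar κ : ℂ)) ≤ 2 / (16 / (b : ℝ) ^ 2) :=
        div_le_div_of_nonneg_left (by norm_num) (by positivity) h2
    _ = (b : ℝ) ^ 2 / 8 := by field_simp; norm_num

end Fourier

/-! ### Walsh coefficients of the averaged kernel -/

section Walsh

variable {b : ℕ}

lemma eq_zero_iff_head_tail {m : ℕ} (k : Fin (m + 1) → ZMod b) :
    k = 0 ↔ k 0 = 0 ∧ Fin.tail k = 0 := by
  constructor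
  · rintro rfl
    exact ⟨rfl, rfl⟩
  · rintro ⟨h0, ht⟩
    funext i
    refine Fin.cases h0 (fun i => ?_) i
    exact congrFun ht i

/-- The number of digits of `k`: the least `a` with `k i = 0` for all `i ≥ a`. -/
def level : {m : ℕ} → (Fin m → ZMod b) → ℕ
  | 0, _ => 0
  | _ + 1, k => if Fin.tail k = 0 then (if k 0 = 0 then 0 else 1) else level (Fin.tail k) + 1

lemma level_eq_zero_iff {m : ℕ} (k : Fin m → ZMod b) : level k = 0 ↔ k = 0 := by
  cases m with
  | zero => exact ⟨fun _ => Subsingleton.elim _ _, fun _ => rfl⟩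
  | succ m =>
    rw [eq_zero_iff_head_tail, level]
    split_ifs with h1 h2 <;> simp [*]

lemma level_le {m : ℕ} (k : Fin m → ZMod b) : level k ≤ m := by
  induction m with
  | zero => exact le_rfl
  | succ m ih =>
    rw [level]
    have := ih (Fin.tail k)
    split_ifs <;> omega

lemma eq_zero_of_level_le {m : ℕ} (k : Fin m → ZMod b) (i : Fin m) (h : level k ≤ i) :
    k i = 0 := by
  induction m with
  | zero => exact i.elim0
  | succ m ih =>
    rw [level] at h
    split_ifs at h with h1 h2
    · rw [(eq_zero_iff_head_tail k).2 ⟨h2, h1⟩]; rfl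
    · refine Fin.cases (fun h => ?_) (fun i _ => ?_) i h
      · simp at h
      · exact congrFun h1 i
    · refine Fin.cases (fun h => ?_) (fun i h => ?_) i h
      · simp at h
      · exact ih (Fin.tail k) i (by simpa using h)

lemma cons_sub_cons {m : ℕ} (x s : ZMod b) (x' s' : Fin m → ZMod b) :
    (Fin.cons x x' : Fin (m + 1) → ZMod b) - Fin.cons s s' = Fin.cons (x - s) (x' - s') := by
  funext i
  refine Fin.cases ?_ (fun i => ?_) i <;> simp

variable [NeZero b]

/-- The Walsh coefficients of `absMean`. -/
noncomputable def absCoeff : {m : ℕ} → (Fin m → ZMod b) → ℝ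
  | 0, _ => 1 / 3
  | _ + 1, k => (absCoeff (Fin.tail k) + if Fin.tail k = 0 then 2 * digitCoeff (k 0) else 0)
      / (b : ℝ) ^ 2

/-- The Walsh coefficients of `sqMean`. -/
noncomputable def sqCoeff : {m : ℕ} → (Fin m → ZMod b) → ℝ
  | 0, _ => 1 / 6
  | _ + 1, k => ((if k 0 = 0 then sqCoeff (Fin.tail k) else 0)
      + if Fin.tail k = 0 then digitCoeff (k 0) else 0) / (b : ℝ) ^ 2

lemma stdAddChar_cons_dotProduct {m : ℕ} (k0 h0 : ZMod b) (k h : Fin m → ZMod b) :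
    (ZMod.stdAddChar ((Fin.cons k0 k : Fin (m + 1) → ZMod b) ⬝ᵥ Fin.cons h0 h) : ℂ)
      = ZMod.stdAddChar (k0 * h0) * ZMod.stdAddChar (k ⬝ᵥ h) := by
  rw [← AddChar.map_add_eq_mul]
  congr 1
  simp [dotProduct, Fin.sum_univ_succ]

/-- Induction through `absMean_cons`. The indicator of equal leading digits is the mean of all
characters, so a tail coefficient is copied to every leading frequency; the digit form does not see
the tail, so it enters only at tail frequency zero. -/
lemma absMean_eq_sum {m : ℕ} (x y : Fin m → ZMod b) :
    (absMean x y : ℂ) = ∑ k : Fin m → ZMod b,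
      (absCoeff k : ℂ) * ZMod.stdAddChar (k ⬝ᵥ (x - y)) := by
  have hb : (b : ℂ) ≠ 0 := by exact_mod_cast NeZero.ne b
  induction m with
  | zero => simp [absMean_zero, absCoeff]
  | succ m ih =>
    rw [← Fin.cons_self_tail x, ← Fin.cons_self_tail y, absMean_cons, sum_fin_cons, cons_sub_cons]
    simp only [stdAddChar_cons_dotProduct, absCoeff, Fin.tail_cons, Fin.cons_zero]
    set h0 := x 0 - y 0
    have e1 : ∀ k0 : ZMod b, ∀ k : Fin m → ZMod b,
        ((((absCoeff k + if k = 0 then 2 * digitCoeff k0 else 0) / (b : ℝ) ^ 2 : ℝ) : ℂ)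
          * (ZMod.stdAddChar (k0 * h0) * ZMod.stdAddChar (k ⬝ᵥ (Fin.tail x - Fin.tail y))))
        = (ZMod.stdAddChar (k0 * h0) / (b : ℂ) ^ 2)
            * ((absCoeff k : ℂ) * ZMod.stdAddChar (k ⬝ᵥ (Fin.tail x - Fin.tail y)))
          + if k = 0 then 2 / (b : ℂ) ^ 2 * ((digitCoeff k0 : ℂ) * ZMod.stdAddChar (k0 * h0))
            else 0 := by
      intro k0 k
      split_ifs with hk
      · subst hk
        simp only [zero_dotProduct, AddChar.map_zero_eq_one]
        push_cast
        ring
      · push_cast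
        ring
    simp only [e1, Finset.sum_add_distrib, ← Finset.mul_sum, ← ih, Finset.sum_ite_eq',
      Finset.mem_univ, if_true, ← digitForm_eq_sum, ← Finset.sum_mul, ← Finset.sum_div,
      sum_stdAddChar_mul]
    have e2 : (x 0 = y 0) ↔ h0 = 0 := sub_eq_zero.symm
    simp only [e2]
    push_cast
    split_ifs
    · field_simp
    · simp
      ring

/-- In contrast to the mean distance, the tail term here is independent of the leading digits, so it
survives only at leading frequency zero. -/
lemma sqMean_eq_sum {m : ℕ} (x y : Fin m → ZMod b) :
    (sqMean x y : ℂ) = ∑ k : Fin m → ZMod b,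
      (sqCoeff k : ℂ) * ZMod.stdAddChar (k ⬝ᵥ (x - y)) := by
  have hb : (b : ℂ) ≠ 0 := by exact_mod_cast NeZero.ne b
  induction m with
  | zero => simp [sqMean_zero, sqCoeff]
  | succ m ih =>
    rw [← Fin.cons_self_tail x, ← Fin.cons_self_tail y, sqMean_cons, sum_fin_cons, cons_sub_cons]
    simp only [stdAddChar_cons_dotProduct, sqCoeff, Fin.tail_cons, Fin.cons_zero]
    set h0 := x 0 - y 0
    have e1 : ∀ k0 : ZMod b, ∀ k : Fin m → ZMod b,
        (((((if k0 = 0 then sqCoeff k else 0) + if k = 0 then digitCoeff k0 else 0)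
            / (b : ℝ) ^ 2 : ℝ) : ℂ)
          * (ZMod.stdAddChar (k0 * h0) * ZMod.stdAddChar (k ⬝ᵥ (Fin.tail x - Fin.tail y))))
        = (if k0 = 0 then 1 / (b : ℂ) ^ 2 else 0)
            * ((sqCoeff k : ℂ) * ZMod.stdAddChar (k ⬝ᵥ (Fin.tail x - Fin.tail y)))
          + if k = 0 then 1 / (b : ℂ) ^ 2 * ((digitCoeff k0 : ℂ) * ZMod.stdAddChar (k0 * h0))
            else 0 := by
      intro k0 k
      have e3 : k0 = 0 → (ZMod.stdAddChar (k0 * h0) : ℂ) = 1 := by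
        rintro rfl
        simp
      split_ifs with hk0 hk hk
      · subst hk
        simp only [zero_dotProduct, AddChar.map_zero_eq_one, e3 hk0]
        push_cast
        ring
      · rw [e3 hk0]
        push_cast
        ring
      · subst hk
        simp only [zero_dotProduct, AddChar.map_zero_eq_one]
        push_cast
        ring
      · simp
    simp only [e1, Finset.sum_add_distrib, ← Finset.mul_sum, ← ih, Finset.sum_ite_eq',
      Finset.mem_univ, if_true, ← digitForm_eq_sum, ← Finset.sum_mul]
    push_cast
    ring

/-- The kernel of the periodic discrepancy, averaged over the shifts of two points with digits
`x` and `y`. -/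
noncomputable def shiftKernel {m : ℕ} (x y : Fin m → ZMod b) : ℝ :=
  1 / 2 - absMean x y + sqMean x y

/-- The Walsh coefficients of `shiftKernel`. -/
noncomputable def kernelCoeff {m : ℕ} (k : Fin m → ZMod b) : ℝ :=
  (if k = 0 then 1 / 2 else 0) - absCoeff k + sqCoeff k

lemma shiftKernel_eq_sum {m : ℕ} (x y : Fin m → ZMod b) :
    (shiftKernel x y : ℂ) = ∑ k : Fin m → ZMod b,
      (kernelCoeff k : ℂ) * ZMod.stdAddChar (k ⬝ᵥ (x - y)) := by
  have : ∀ k : Fin m → ZMod b, (kernelCoeff k : ℂ) * ZMod.stdAddChar (k ⬝ᵥ (x - y))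
      = (if k = 0 then 1 / 2 else 0) - (absCoeff k : ℂ) * ZMod.stdAddChar (k ⬝ᵥ (x - y))
        + (sqCoeff k : ℂ) * ZMod.stdAddChar (k ⬝ᵥ (x - y)) := by
    intro k
    rw [kernelCoeff]
    split_ifs with hk
    · subst hk
      simp
    · push_cast
      ring
  simp only [this, Finset.sum_add_distrib, Finset.sum_sub_distrib, ← absMean_eq_sum,
    ← sqMean_eq_sum, Finset.sum_ite_eq', Finset.mem_univ, if_true, shiftKernel]
  push_cast
  ring

lemma shiftKernel_sub {m : ℕ} (x y : Fin m → ZMod b) : shiftKernel x y = shiftKernel (x - y) 0 := by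
  have := (shiftKernel_eq_sum x y).trans (by rw [shiftKernel_eq_sum (x - y) 0, sub_zero] :
    _ = (shiftKernel (x - y) 0 : ℂ))
  exact_mod_cast this

lemma absCoeff_zero (m : ℕ) : absCoeff (0 : Fin m → ZMod b) = 1 / 3 := by
  have hb : (b : ℝ) ≠ 0 := by exact_mod_cast NeZero.ne b
  induction m with
  | zero => rfl
  | succ m ih =>
    rw [absCoeff, show Fin.tail (0 : Fin (m + 1) → ZMod b) = 0 from rfl, ih, if_pos rfl, Pi.zero_apply,
      digitCoeff, if_pos rfl]
    field_simp
    ring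

lemma sqCoeff_zero (m : ℕ) : sqCoeff (0 : Fin m → ZMod b) = 1 / 6 := by
  have hb : (b : ℝ) ≠ 0 := by exact_mod_cast NeZero.ne b
  induction m with
  | zero => rfl
  | succ m ih =>
    rw [sqCoeff, show Fin.tail (0 : Fin (m + 1) → ZMod b) = 0 from rfl, ih, if_pos rfl, Pi.zero_apply,
      digitCoeff, if_pos rfl, if_pos rfl]
    field_simp
    ring

lemma kernelCoeff_zero (m : ℕ) : kernelCoeff (0 : Fin m → ZMod b) = 1 / 3 := by
  rw [kernelCoeff, if_pos rfl, absCoeff_zero, sqCoeff_zero]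
  norm_num

/-- S is `digitSine` at the last nonzero digit of k; q equals S when that is the only nonzero digit
and is 0 otherwise. The 1/3 is the coefficient at the zero frequency that follows the last nonzero
digit. -/
lemma exists_coeff_eq {m : ℕ} (k : Fin m → ZMod b) (hk : k ≠ 0) :
    ∃ S q : ℝ, 1 / 2 ≤ S ∧ S ≤ (b : ℝ) ^ 2 / 8 ∧ 0 ≤ q ∧ q ≤ S ∧
      absCoeff k = (1 / 3 - 2 * S) / ((b : ℝ) ^ 2) ^ level k ∧
      sqCoeff k = -q / ((b : ℝ) ^ 2) ^ level k := by
  have hb : (b : ℝ) ≠ 0 := by exact_mod_cast NeZero.ne b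
  induction m with
  | zero => exact absurd (Subsingleton.elim _ _) hk
  | succ m ih =>
    by_cases ht : Fin.tail k = 0
    · have h0 : k 0 ≠ 0 := fun h0 => hk ((eq_zero_iff_head_tail k).2 ⟨h0, ht⟩)
      have hS := half_le_digitSine h0
      refine ⟨digitSine (k 0), digitSine (k 0), hS, digitSine_le h0, by linarith, le_rfl, ?_, ?_⟩
      · rw [absCoeff, level, if_pos ht, if_pos ht, if_neg h0, ht, absCoeff_zero, digitCoeff,
          if_neg h0]
        ring
      · rw [sqCoeff, level, if_pos ht, if_pos ht, if_neg h0, if_neg h0, digitCoeff, if_neg h0]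
        ring
    · obtain ⟨S, q, h1, h2, h3, h4, h5, h6⟩ := ih (Fin.tail k) ht
      by_cases h0 : k 0 = 0
      · refine ⟨S, q, h1, h2, h3, h4, ?_, ?_⟩
        · rw [absCoeff, level, if_neg ht, if_neg ht, h5, add_zero, div_div, pow_succ (_ ^ 2)]
        · rw [sqCoeff, level, if_neg ht, if_neg ht, if_pos h0, h6, add_zero, div_div, pow_succ (_ ^ 2)]
      · refine ⟨S, 0, h1, h2, le_rfl, by linarith, ?_, ?_⟩
        · rw [absCoeff, level, if_neg ht, if_neg ht, h5, add_zero, div_div, pow_succ (_ ^ 2)]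
        · rw [sqCoeff, if_neg ht, if_neg h0]
          simp

/-- The bound for the Walsh coefficients of `shiftKernel` at frequencies with `a` digits. -/
noncomputable def coeffBound (b a : ℕ) : ℝ :=
  if a = 0 then 1 / 3 else ((b : ℝ) ^ 2 / 4 - 1 / 3) / ((b : ℝ) ^ 2) ^ a

lemma abs_kernelCoeff_le {m : ℕ} (k : Fin m → ZMod b) :
    |kernelCoeff k| ≤ coeffBound b (level k) := by
  have hb : (0 : ℝ) < b := by exact_mod_cast Nat.pos_of_ne_zero (NeZero.ne b)
  by_cases hk : k = 0
  · subst hk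
    rw [kernelCoeff_zero, coeffBound, if_pos ((level_eq_zero_iff _).2 rfl)]
    norm_num
  · obtain ⟨S, q, h1, h2, h3, h4, h5, h6⟩ := exists_coeff_eq k hk
    rw [kernelCoeff, coeffBound, if_neg hk, if_neg (by rwa [level_eq_zero_iff]), h5, h6, zero_sub,
      ← neg_div, ← add_div, abs_div, abs_of_pos (a := ((b : ℝ) ^ 2) ^ level k) (by positivity)]
    refine div_le_div_of_nonneg_right ?_ (by positivity)
    -- The numerator is 2S - q - 1/3, which lies between S - 1/3 > 0 and b²/4 - 1/3.
    rw [abs_le]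
    constructor <;> linarith

end Walsh

/-! ### The dual net and character orthogonality -/

lemma exists_le_sum_eq {d : ℕ} (a : Fin d → ℕ) (M : ℕ) (h : M ≤ ∑ j, a j) :
    ∃ ℓ : Fin d → ℕ, (∀ j, ℓ j ≤ a j) ∧ ∑ j, ℓ j = M := by
  induction M with
  | zero => exact ⟨0, by simp, by simp⟩
  | succ M ih =>
    obtain ⟨ℓ, h1, h2⟩ := ih (by omega)
    obtain ⟨j, -, hj⟩ := Finset.exists_lt_of_sum_lt (s := Finset.univ) (f := ℓ) (g := a) (by omega)
    refine ⟨ℓ + Pi.single j 1, fun i => ?_, ?_⟩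
    · by_cases hi : i = j
      · subst hi
        simpa using hj
      · simpa [hi] using h1 i
    · simp [Finset.sum_add_distrib, h2, Finset.sum_pi_single']

lemma exists_ge_sum_eq {d : ℕ} (hd : 1 ≤ d) (a : Fin d → ℕ) (M : ℕ) (h : ∑ j, a j ≤ M) :
    ∃ ℓ : Fin d → ℕ, (∀ j, a j ≤ ℓ j) ∧ ∑ j, ℓ j = M := by
  refine ⟨a + Pi.single ⟨0, hd⟩ (M - ∑ j, a j), fun i => by simp, ?_⟩
  simp only [Pi.add_apply, Finset.sum_add_distrib, Finset.sum_pi_single', Finset.mem_univ, if_true]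
  omega

section Dual

variable {b t m d : ℕ} [NeZero b]

/-- The dual net of the net generated by `C`. -/
def dualNet (C : Fin d → Matrix (Fin m) (Fin m) (ZMod b)) : Finset (Fin d → Fin m → ZMod b) :=
  Finset.univ.filter fun k => ∑ j, Matrix.vecMul (k j) (C j) = 0

lemma mem_dualNet {C : Fin d → Matrix (Fin m) (Fin m) (ZMod b)} {k : Fin d → Fin m → ZMod b} :
    k ∈ dualNet C ↔ ∑ j, Matrix.vecMul (k j) (C j) = 0 := by
  simp [dualNet]

/-- Membership in the dual net is a linear relation among the rows of the matrices; here it involves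
only rows that the net property makes independent. -/
lemma eq_zero_of_mem_dualNet {C : Fin d → Matrix (Fin m) (Fin m) (ZMod b)}
    (hC : IsGenerating b t m d C) {ℓ : Fin d → ℕ} (hℓ : (∑ j, ℓ j) + t = m)
    {k : Fin d → Fin m → ZMod b} (hk : k ∈ dualNet C)
    (h0 : ∀ j, ∀ i : Fin m, ℓ j ≤ i → k j i = 0) : k = 0 := by
  have hli := Fintype.linearIndependent_iff.1 (hC.2 ℓ hℓ)
    (fun p => k p.1.1 p.1.2) (by
      rw [mem_dualNet] at hk
      simp only [Matrix.vecMul_eq_sum] at hk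
      rw [← Finset.sum_subtype (Finset.univ.filter fun p : Fin d × Fin m => (p.2 : ℕ) < ℓ p.1)
        (by simp) (fun p : Fin d × Fin m => k p.1 p.2 • (C p.1 p.2 : Fin m → ZMod b)),
        Finset.sum_filter_of_ne, Fintype.sum_prod_type]
      · exact hk
      · intro p _ hp
        by_contra hlt
        exact hp (by rw [h0 p.1 p.2 (not_lt.1 hlt), zero_smul]))
  funext j i
  rcases lt_or_ge (i : ℕ) (ℓ j) with h | h
  · exact hli ⟨(j, i), h⟩
  · exact h0 j i h

/-- Otherwise the levels could be enlarged to a vector of sum m - t, and the rows involved would be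
independent. -/
lemma sum_level_gt_of_mem_dualNet {C : Fin d → Matrix (Fin m) (Fin m) (ZMod b)} (hd : 1 ≤ d)
    (hC : IsGenerating b t m d C) {k : Fin d → Fin m → ZMod b} (hk : k ∈ dualNet C) (h0 : k ≠ 0) :
    m - t < ∑ j, level (k j) := by
  by_contra hlt
  obtain ⟨ℓ, h1, h2⟩ := exists_ge_sum_eq hd (fun j => level (k j)) (m - t) (not_lt.1 hlt)
  have htm := hC.1
  exact h0 (eq_zero_of_mem_dualNet hC (ℓ := ℓ) (by omega) hk
    fun j i hi => eq_zero_of_level_le _ _ ((h1 j).trans hi))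

lemma card_dualNet_level_le {C : Fin d → Matrix (Fin m) (Fin m) (ZMod b)}
    (hC : IsGenerating b t m d C) (a : Fin d → ℕ) (ha : m - t ≤ ∑ j, a j) :
    ((dualNet C).filter fun k => ∀ j, level (k j) = a j).card ≤ b ^ (∑ j, a j - (m - t)) := by
  obtain ⟨ℓ, h1, h2⟩ := exists_le_sum_eq a (m - t) ha
  have htm := hC.1
  -- Φ records the digits in positions ℓ_j ≤ i < a_j. Two dual vectors with the same record differ
  -- by a dual vector supported on the first ℓ_j positions, which vanishes. The default 0 only
  -- serves positions beyond m.
  let Φ : (Fin d → Fin m → ZMod b) → (∀ j : Fin d, Fin (a j - ℓ j) → ZMod b) := fun k j i =>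
    if h : ℓ j + i < m then k j ⟨ℓ j + i, h⟩ else 0
  have hcard : Fintype.card (∀ j : Fin d, Fin (a j - ℓ j) → ZMod b) = b ^ (∑ j, a j - (m - t)) := by
    rw [Fintype.card_pi]
    simp only [Fintype.card_fun, ZMod.card, Fintype.card_fin]
    rw [Finset.prod_pow_eq_pow_sum, Finset.sum_tsub_distrib _ fun j _ => h1 j, h2]
  rw [← hcard, ← Finset.card_univ]
  refine Finset.card_le_card_of_injOn Φ (fun _ _ => Finset.mem_univ _) ?_
  intro k hk k' hk' he
  simp only [Finset.coe_filter, Set.mem_ofPred_eq] at hk hk'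
  have hmem : k - k' ∈ dualNet C := by
    rw [mem_dualNet]
    simp only [Pi.sub_apply, Matrix.sub_vecMul, Finset.sum_sub_distrib]
    rw [mem_dualNet.1 hk.1, mem_dualNet.1 hk'.1, sub_zero]
  refine sub_eq_zero.1 (eq_zero_of_mem_dualNet hC (ℓ := ℓ) (by omega) hmem fun j i hi => ?_)
  simp only [Pi.sub_apply, sub_eq_zero]
  rcases lt_or_ge (i : ℕ) (a j) with h | h
  · have := congrFun (congrFun he j) ⟨i - ℓ j, by omega⟩
    simp only [Φ] at this
    have e : ℓ j + ((i : ℕ) - ℓ j) = i := by omega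
    simpa [e] using this
  · rw [eq_zero_of_level_le _ _ ((hk.2 j).trans_le h), eq_zero_of_level_le _ _ ((hk'.2 j).trans_le h)]

lemma stdAddChar_sum {ι : Type*} (s : Finset ι) (f : ι → ZMod b) :
    (ZMod.stdAddChar (∑ i ∈ s, f i) : ℂ) = ∏ i ∈ s, (ZMod.stdAddChar (f i) : ℂ) := by
  classical
  induction s using Finset.induction_on with
  | empty => simp
  | insert i s hi ih => rw [Finset.sum_insert hi, Finset.prod_insert hi, AddChar.map_add_eq_mul, ih]

lemma sum_stdAddChar_dotProduct (w : Fin m → ZMod b) :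
    ∑ v : Fin m → ZMod b, (ZMod.stdAddChar (w ⬝ᵥ v) : ℂ) = if w = 0 then (b : ℂ) ^ m else 0 := by
  have h1 : ∀ v : Fin m → ZMod b, (ZMod.stdAddChar (w ⬝ᵥ v) : ℂ)
      = ∏ i, (ZMod.stdAddChar (v i * w i) : ℂ) := by
    intro v
    rw [← stdAddChar_sum]
    simp [dotProduct, mul_comm]
  simp only [h1]
  rw [← Fintype.prod_sum (fun (i : Fin m) (x : ZMod b) => (ZMod.stdAddChar (x * w i) : ℂ))]
  simp only [sum_stdAddChar_mul]
  split_ifs with h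
  · subst h
    simp
  · obtain ⟨i, hi⟩ := Function.ne_iff.1 h
    exact Finset.prod_eq_zero (Finset.mem_univ i) (if_neg hi)

/-- Poisson summation: after expansion, the character of v has frequency ∑ k_j C_j, and summing over
v keeps exactly those k for which it is zero. -/
lemma sum_prod_shiftKernel (C : Fin d → Matrix (Fin m) (Fin m) (ZMod b)) :
    ∑ v : Fin m → ZMod b, ∏ j, shiftKernel ((C j).mulVec v) 0
      = (b : ℝ) ^ m * ∑ k ∈ dualNet C, ∏ j, kernelCoeff (k j) := by
  have key : (∑ v : Fin m → ZMod b, ∏ j, (shiftKernel ((C j).mulVec v) 0 : ℂ))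
      = (b : ℂ) ^ m * ∑ k ∈ dualNet C, ∏ j, (kernelCoeff (k j) : ℂ) := by
    simp only [shiftKernel_eq_sum, sub_zero, Fintype.prod_sum]
    rw [Finset.sum_comm, dualNet, Finset.mul_sum, Finset.sum_filter]
    refine Finset.sum_congr rfl fun k _ => ?_
    have : ∀ v : Fin m → ZMod b,
        ∏ j, ((kernelCoeff (k j) : ℂ) * ZMod.stdAddChar (k j ⬝ᵥ (C j).mulVec v))
        = (∏ j, (kernelCoeff (k j) : ℂ)) * ZMod.stdAddChar ((∑ j, Matrix.vecMul (k j) (C j)) ⬝ᵥ v) := by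
      intro v
      rw [Finset.prod_mul_distrib, ← stdAddChar_sum, sum_dotProduct]
      simp only [Matrix.dotProduct_mulVec]
    simp only [this, ← Finset.mul_sum, sum_stdAddChar_dotProduct]
    split_ifs <;> ring
  exact_mod_cast key

end Dual

/-! ### Weighted sums over level vectors -/

section Tail

/-- `coeffBound b a` times the number `b ^ a` of digit vectors. -/
noncomputable def tailWeight (b a : ℕ) : ℝ :=
  if a = 0 then 1 / 3 else ((b : ℝ) ^ 2 / 4 - 1 / 3) * (1 / (b : ℝ)) ^ a

lemma coeffBound_eq {b : ℕ} (hb : 2 ≤ b) (a : ℕ) :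
    coeffBound b a = tailWeight b a * (1 / (b : ℝ)) ^ a := by
  have : (b : ℝ) ≠ 0 := by positivity
  rw [coeffBound, tailWeight]
  split_ifs with h
  · simp [h]
  · rw [mul_assoc, ← mul_pow, div_eq_mul_inv, ← inv_pow]
    congr 2
    field_simp

lemma const_pos {b : ℕ} (hb : 2 ≤ b) : (0 : ℝ) < (b : ℝ) ^ 2 / 4 - 1 / 3 := by
  have : (2 : ℝ) ≤ b := by exact_mod_cast hb
  nlinarith

lemma tailWeight_nonneg {b : ℕ} (hb : 2 ≤ b) (a : ℕ) : 0 ≤ tailWeight b a := by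
  have := const_pos hb
  rw [tailWeight]
  split_ifs <;> positivity

/-- The sum of the products of weights over the vectors `a ∈ {0, …, m}^d` of sum more than `M`. -/
noncomputable def tailSum (b m d M : ℕ) : ℝ :=
  ∑ a : Fin d → Fin (m + 1), if M < ∑ j, (a j : ℕ) then ∏ j, tailWeight b (a j) else 0

/-- The sum of the products of weights over all vectors `a ∈ {0, …, m}^d`. -/
noncomputable def fullSum (b m d : ℕ) : ℝ :=
  ∑ a : Fin d → Fin (m + 1), ∏ j, tailWeight b (a j)

lemma tailSum_le_fullSum {b : ℕ} (hb : 2 ≤ b) (m d M : ℕ) : tailSum b m d M ≤ fullSum b m d := by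
  refine Finset.sum_le_sum fun a _ => ?_
  split_ifs
  · exact le_rfl
  · exact Finset.prod_nonneg fun j _ => tailWeight_nonneg hb _

lemma sum_tail_geom_le {b : ℕ} (hb : 2 ≤ b) (M n : ℕ) :
    ∑ i ∈ Finset.Ico M n, (1 / (b : ℝ)) ^ i ≤ (1 / (b : ℝ)) ^ M * (b / ((b : ℝ) - 1)) := by
  have h2 : (2 : ℝ) ≤ b := by exact_mod_cast hb
  have h := geom_sum_Ico_le_of_lt_one (x := 1 / (b : ℝ)) (m := M) (n := n) (by positivity)
    (by rw [div_lt_one (by linarith)]; linarith)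
  refine h.trans (le_of_eq ?_)
  have : (b : ℝ) - 1 ≠ 0 := by linarith
  field_simp

lemma fullSum_le {b : ℕ} (hb : 2 ≤ b) (m d : ℕ) :
    fullSum b m d ≤ (1 / 3 + ((b : ℝ) ^ 2 / 4 - 1 / 3) / ((b : ℝ) - 1)) ^ d := by
  have h2 : (2 : ℝ) ≤ b := by exact_mod_cast hb
  have hc := const_pos hb
  rw [fullSum, ← Fintype.prod_sum (fun (_ : Fin d) (i : Fin (m + 1)) => tailWeight b i),
    Finset.prod_const, Finset.card_univ, Fintype.card_fin]
  refine pow_le_pow_left₀ (Finset.sum_nonneg fun i _ => tailWeight_nonneg hb _) ?_ d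
  rw [Fin.sum_univ_eq_sum_range (fun i => tailWeight b i), Finset.range_eq_Ico,
    Finset.sum_eq_sum_Ico_succ_bot (by omega)]
  refine add_le_add (by simp [tailWeight]) ?_
  have : ∀ i ∈ Finset.Ico (0 + 1) (m + 1), tailWeight b i
      = ((b : ℝ) ^ 2 / 4 - 1 / 3) * (1 / (b : ℝ)) ^ i := by
    intro i hi
    rw [tailWeight, if_neg (by have := (Finset.mem_Ico.1 hi).1; omega)]
  rw [Finset.sum_congr rfl this, ← Finset.mul_sum, div_eq_mul_inv]
  refine mul_le_mul_of_nonneg_left ((sum_tail_geom_le hb _ _).trans (le_of_eq ?_)) hc.le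
  have : (b : ℝ) - 1 ≠ 0 := by linarith
  rw [zero_add, pow_one]
  field_simp

/-- Split off the first entry i. The other entries must add up to more than M - i, which is no
condition once i > M. -/
lemma tailSum_succ (b m d M : ℕ) :
    tailSum b m (d + 1) M = ∑ i ∈ Finset.range (m + 1),
      tailWeight b i * if i ≤ M then tailSum b m d (M - i) else fullSum b m d := by
  rw [← Fin.sum_univ_eq_sum_range
    (fun i => tailWeight b i * if i ≤ M then tailSum b m d (M - i) else fullSum b m d), tailSum,
    ← Fintype.sum_equiv (Fin.consEquiv fun _ : Fin (d + 1) => Fin (m + 1))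
      (fun p => if M < (p.1 : ℕ) + ∑ j, (p.2 j : ℕ) then
        tailWeight b p.1 * ∏ j, tailWeight b (p.2 j) else 0) _
      (fun p => by simp [Fin.sum_univ_succ, Fin.prod_univ_succ, Fin.consEquiv]),
    Fintype.sum_prod_type]
  refine Finset.sum_congr rfl fun i _ => ?_
  split_ifs with h
  · rw [tailSum, Finset.mul_sum]
    refine Finset.sum_congr rfl fun a _ => ?_
    rw [mul_ite, mul_zero]
    refine if_congr ?_ rfl rfl
    simp only []
    omega
  · rw [fullSum, Finset.mul_sum]
    refine Finset.sum_congr rfl fun a _ => ?_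
    rw [if_pos (by simp only []; omega)]

lemma tailSum_one_le {b : ℕ} (hb : 2 ≤ b) (m M : ℕ) :
    tailSum b m 1 M ≤ 3 / 5 * ((1 + (b : ℝ) ^ 2) / 3) * (1 / (b : ℝ)) ^ M := by
  have h2 : (2 : ℝ) ≤ b := by exact_mod_cast hb
  have hc := const_pos hb
  have e1 : tailSum b m 1 M = ∑ i ∈ Finset.range (m + 1), if M < i then tailWeight b i else 0 := by
    rw [tailSum_succ]
    refine Finset.sum_congr rfl fun i _ => ?_
    simp only [tailSum, fullSum, Finset.univ_eq_empty, Finset.sum_empty, Finset.prod_empty]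
    by_cases h : M < i
    · simp [h, not_le.2 h]
    · simp [h, not_lt.1 h]
  have e2 : Finset.filter (fun i => M < i) (Finset.range (m + 1)) = Finset.Ico (M + 1) (m + 1) := by
    ext i
    simp
    omega
  rw [e1, ← Finset.sum_filter, e2]
  have : ∀ i ∈ Finset.Ico (M + 1) (m + 1), tailWeight b i
      = ((b : ℝ) ^ 2 / 4 - 1 / 3) * (1 / (b : ℝ)) ^ i := by
    intro i hi
    rw [tailWeight, if_neg (by have := (Finset.mem_Ico.1 hi).1; omega)]
  rw [Finset.sum_congr rfl this, ← Finset.mul_sum]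
  refine (mul_le_mul_of_nonneg_left (sum_tail_geom_le hb _ _) hc.le).trans ?_
  have e3 : ((b : ℝ) ^ 2 / 4 - 1 / 3) * ((1 / (b : ℝ)) ^ (M + 1) * (b / ((b : ℝ) - 1)))
      = ((b : ℝ) ^ 2 / 4 - 1 / 3) / ((b : ℝ) - 1) * (1 / (b : ℝ)) ^ M := by
    have : (b : ℝ) - 1 ≠ 0 := by linarith
    rw [pow_succ (1 / (b : ℝ)) M]
    generalize (1 / (b : ℝ)) ^ M = z
    field_simp
  rw [e3]
  refine mul_le_mul_of_nonneg_right ?_ (by positivity)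
  rw [div_le_iff₀ (by linarith)]
  nlinarith [mul_nonneg (sub_nonneg.2 h2) (sq_nonneg ((b : ℝ) - 2))]

/-- Controls the entries i ≥ M in the induction for `tailSum_le`. The constant 3/5 is forced here: β
= 2, n = 0 is a case of equality. -/
lemma weight_const_le {β : ℝ} (hβ : 2 ≤ β) (n : ℕ) :
    (β ^ 2 / 4 - 1 / 3) * (β / (β - 1)) * (1 / 3 + (β ^ 2 / 4 - 1 / 3) / (β - 1)) ^ (n + 1)
      ≤ 3 / 5 * ((1 + β ^ 2) / 3) ^ (n + 1) * (β ^ 2 / 3) := by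
  -- In the variable s = β - 2 the polynomials to be compared have differences with nonnegative
  -- coefficients.
  obtain ⟨s, hs, rfl⟩ : ∃ s : ℝ, 0 ≤ s ∧ β = s + 2 := ⟨β - 2, by linarith, by ring⟩
  have h1 : (0 : ℝ) < s + 2 - 1 := by linarith
  have hc : 0 ≤ (s + 2) ^ 2 / 4 - 1 / 3 := by nlinarith
  have hW0 : 0 ≤ 1 / 3 + ((s + 2) ^ 2 / 4 - 1 / 3) / (s + 2 - 1) := by positivity
  have hW : 1 / 3 + ((s + 2) ^ 2 / 4 - 1 / 3) / (s + 2 - 1) ≤ (1 + (s + 2) ^ 2) / 3 := by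
    rw [← sub_nonneg]
    have : (1 + (s + 2) ^ 2) / 3 - (1 / 3 + ((s + 2) ^ 2 / 4 - 1 / 3) / (s + 2 - 1))
        = (4 * s ^ 3 + 17 * s ^ 2 + 20 * s + 8) / (12 * (s + 2 - 1)) := by
      field_simp
      ring
    rw [this]
    positivity
  have h3 : ((s + 2) ^ 2 / 4 - 1 / 3) * ((s + 2) / (s + 2 - 1))
      * (1 / 3 + ((s + 2) ^ 2 / 4 - 1 / 3) / (s + 2 - 1))
      ≤ 3 / 5 * ((1 + (s + 2) ^ 2) / 3) * ((s + 2) ^ 2 / 3) := by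
    rw [← sub_nonneg]
    have : 3 / 5 * ((1 + (s + 2) ^ 2) / 3) * ((s + 2) ^ 2 / 3)
        - ((s + 2) ^ 2 / 4 - 1 / 3) * ((s + 2) / (s + 2 - 1))
      * (1 / 3 + ((s + 2) ^ 2 / 4 - 1 / 3) / (s + 2 - 1))
        = (s + 2) * (144 * (s + 2) * (1 + (s + 2) ^ 2) * (s + 1) ^ 2
          - 15 * (3 * (s + 2) ^ 2 - 4) * (3 * (s + 2) ^ 2 + 4 * (s + 2) - 8))
          / (2160 * (s + 2 - 1) ^ 2) := by
      field_simp
      ring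
    rw [this]
    refine div_nonneg (mul_nonneg (by linarith) ?_) (by positivity)
    ring_nf
    positivity
  rw [pow_succ, pow_succ]
  calc _ = (((s + 2) ^ 2 / 4 - 1 / 3) * ((s + 2) / (s + 2 - 1))
      * (1 / 3 + ((s + 2) ^ 2 / 4 - 1 / 3) / (s + 2 - 1)))
      * (1 / 3 + ((s + 2) ^ 2 / 4 - 1 / 3) / (s + 2 - 1)) ^ n := by ring
    _ ≤ (3 / 5 * ((1 + (s + 2) ^ 2) / 3) * ((s + 2) ^ 2 / 3)) * ((1 + (s + 2) ^ 2) / 3) ^ n :=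
        mul_le_mul h3 (pow_le_pow_left₀ hW0 hW n) (by positivity) (by positivity)
    _ = _ := by ring

/-- With q = (1 + b²)/3, the induction step multiplies the bound by Mq = 1/3 + (M - 1)q + b²/3. The
first entry i = 0 uses 1/3, each i with 1 ≤ i < M uses at most q, and all i ≥ M together use b²/3.
-/
lemma tailSum_le {b : ℕ} (hb : 2 ≤ b) (m d : ℕ) {M : ℕ} (hM : 1 ≤ M) :
    tailSum b m (d + 1) M
      ≤ 3 / 5 * ((1 + (b : ℝ) ^ 2) / 3) ^ (d + 1) * (1 / (b : ℝ)) ^ M * (M : ℝ) ^ d := by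
  have h2 : (2 : ℝ) ≤ b := by exact_mod_cast hb
  have hc := const_pos hb
  induction d generalizing M with
  | zero => simpa using tailSum_one_le hb m M
  | succ d ih =>
    set c : ℝ := (b : ℝ) ^ 2 / 4 - 1 / 3 with hcdef
    set q : ℝ := (1 + (b : ℝ) ^ 2) / 3 with hq
    set x : ℝ := 1 / (b : ℝ) with hx
    set W : ℝ := 1 / 3 + c / ((b : ℝ) - 1) with hW
    have hx0 : 0 < x := by positivity
    have hq0 : 0 < q := by positivity
    have hM' : (1 : ℝ) ≤ M := by exact_mod_cast hM
    set B : ℝ := c * (3 / 5 * q ^ (d + 1) * x ^ M * (M : ℝ) ^ d) with hB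
    have hB0 : 0 ≤ B := by positivity
    have hb1 : (0 : ℝ) < (b : ℝ) - 1 := by linarith
    have hW0 : 0 ≤ W := by positivity
    -- For i < M the powers x^i and x^(M - i) combine to x^M, so one bound B serves all these i. The
    -- case i = M belongs to the other branch, because the induction hypothesis needs M - i ≥ 1.
    have key : ∀ i ∈ Finset.Ico 1 (m + 1),
        tailWeight b i * (if i ≤ M then tailSum b m (d + 1) (M - i) else fullSum b m (d + 1))
          ≤ if i < M then B else c * W ^ (d + 1) * x ^ i := by
      intro i hi
      have hi1 := (Finset.mem_Ico.1 hi).1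
      rw [tailWeight, if_neg (by omega)]
      by_cases hlt : i < M
      · rw [if_pos hlt, if_pos hlt.le]
        have h3 := ih (M := M - i) (by omega)
        have h4 : ((M - i : ℕ) : ℝ) ^ d ≤ (M : ℝ) ^ d :=
          pow_le_pow_left₀ (by positivity) (by exact_mod_cast Nat.sub_le _ _) _
        have h5 : x ^ M = x ^ i * x ^ (M - i) := by rw [← pow_add]; congr 1; omega
        calc c * x ^ i * tailSum b m (d + 1) (M - i)
            ≤ c * x ^ i * (3 / 5 * q ^ (d + 1) * x ^ (M - i) * (M : ℝ) ^ d) := by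
              refine mul_le_mul_of_nonneg_left (h3.trans ?_) (by positivity)
              exact mul_le_mul_of_nonneg_left h4 (by positivity)
          _ = B := by rw [hB, h5]; ring
      · rw [if_neg hlt]
        have h3 : (if i ≤ M then tailSum b m (d + 1) (M - i) else fullSum b m (d + 1))
            ≤ W ^ (d + 1) := by
          split_ifs
          · exact (tailSum_le_fullSum hb _ _ _).trans (fullSum_le hb _ _)
          · exact fullSum_le hb _ _
        calc c * x ^ i * _ ≤ c * x ^ i * W ^ (d + 1) := mul_le_mul_of_nonneg_left h3 (by positivity)
          _ = _ := by ring
    rw [tailSum_succ, Finset.range_eq_Ico, Finset.sum_eq_sum_Ico_succ_bot (by omega)]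
    have t0 : tailWeight b 0 * (if 0 ≤ M then tailSum b m (d + 1) (M - 0) else fullSum b m (d + 1))
        ≤ 1 / 3 * (3 / 5 * q ^ (d + 1) * x ^ M * (M : ℝ) ^ d) := by
      rw [if_pos (Nat.zero_le _), tailWeight, if_pos rfl]
      exact mul_le_mul_of_nonneg_left (ih hM) (by norm_num)
    have t1 : ∑ i ∈ Finset.Ico (0 + 1) (m + 1),
        tailWeight b i * (if i ≤ M then tailSum b m (d + 1) (M - i) else fullSum b m (d + 1))
        ≤ ((M : ℝ) - 1) * B + c * W ^ (d + 1) * (x ^ M * (b / ((b : ℝ) - 1))) := by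
      refine (Finset.sum_le_sum key).trans ?_
      rw [Finset.sum_ite, Finset.sum_const, ← Finset.mul_sum, nsmul_eq_mul]
      refine add_le_add (mul_le_mul_of_nonneg_right ?_ hB0)
        (mul_le_mul_of_nonneg_left ?_ (by positivity))
      · have : (Finset.filter (fun i => i < M) (Finset.Ico 1 (m + 1))).card ≤ M - 1 := by
          rw [← Nat.card_Ico]
          refine Finset.card_le_card fun i hi => ?_
          simp at hi ⊢
          omega
        have h6 : ((M - 1 : ℕ) : ℝ) = (M : ℝ) - 1 := by push_cast [hM]; ring
        rw [← h6]
        exact_mod_cast this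
      · refine le_trans (Finset.sum_le_sum_of_subset_of_nonneg (t := Finset.Ico M (m + 1)) ?_
          fun _ _ _ => by positivity) (sum_tail_geom_le hb M (m + 1))
        intro i hi
        simp at hi ⊢
        omega
    have t2 := weight_const_le h2 d
    rw [← hcdef, ← hq, ← hW] at t2
    have hcq : c ≤ q := by rw [hcdef, hq]; nlinarith
    have hMd : (1 : ℝ) ≤ (M : ℝ) ^ d := one_le_pow₀ hM'
    set A : ℝ := 3 / 5 * q ^ (d + 1) with hA
    have hA0 : 0 < A := by positivity
    have t3 : c * W ^ (d + 1) * (x ^ M * (b / ((b : ℝ) - 1))) ≤ A * ((b : ℝ) ^ 2 / 3) * x ^ M * (M : ℝ) ^ d := by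
      calc c * W ^ (d + 1) * (x ^ M * (b / ((b : ℝ) - 1)))
          = (c * (b / ((b : ℝ) - 1)) * W ^ (d + 1)) * x ^ M := by ring
        _ ≤ (A * ((b : ℝ) ^ 2 / 3)) * x ^ M := mul_le_mul_of_nonneg_right t2 (by positivity)
        _ ≤ _ := le_mul_of_one_le_right (by positivity) hMd
    have t4 : ((M : ℝ) - 1) * B ≤ ((M : ℝ) - 1) * (q * (A * x ^ M * (M : ℝ) ^ d)) := by
      refine mul_le_mul_of_nonneg_left ?_ (by linarith)
      exact mul_le_mul_of_nonneg_right hcq (by positivity)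
    have t5 : 3 / 5 * q ^ (d + 1 + 1) * x ^ M * (M : ℝ) ^ (d + 1)
        = 1 / 3 * (A * x ^ M * (M : ℝ) ^ d) + ((M : ℝ) - 1) * (q * (A * x ^ M * (M : ℝ) ^ d))
          + A * ((b : ℝ) ^ 2 / 3) * x ^ M * (M : ℝ) ^ d := by
      have : (b : ℝ) ^ 2 / 3 = q - 1 / 3 := by rw [hq]; ring
      rw [this, hA]
      ring
    rw [t5]
    linarith

end Tail

/-! ### Bound for the averaged pair sum -/

section Bound

variable {b t m d : ℕ} [NeZero b]

/-- Group the nonzero dual vectors by their levels a. The count b^(∑ a_j - (m - t)) uses up one of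
the two factors b^(-a_j) in each coefficient bound, leaving the tail weights and a factor b^(-(m -
t)). -/
lemma sum_dualNet_le (hb : 2 ≤ b) (hd : 1 ≤ d) {C : Fin d → Matrix (Fin m) (Fin m) (ZMod b)}
    (hC : IsGenerating b t m d C) :
    ∑ k ∈ dualNet C, ∏ j, kernelCoeff (k j)
      ≤ (1 / 3) ^ d + (1 / (b : ℝ)) ^ (m - t) * tailSum b m d (m - t) := by
  have hb0 : (b : ℝ) ≠ 0 := by positivity
  have h0 : (0 : Fin d → Fin m → ZMod b) ∈ dualNet C := by
    rw [mem_dualNet]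
    simp
  rw [← Finset.add_sum_erase _ _ h0]
  refine add_le_add (le_of_eq (by simp [kernelCoeff_zero])) ?_
  have h1 : ∑ k ∈ (dualNet C).erase 0, ∏ j, kernelCoeff (k j)
      ≤ ∑ k ∈ (dualNet C).erase 0, ∏ j, coeffBound b (level (k j)) := by
    refine Finset.sum_le_sum fun k _ => ?_
    refine (le_abs_self _).trans ?_
    rw [Finset.abs_prod]
    exact Finset.prod_le_prod (fun j _ => abs_nonneg _) fun j _ => abs_kernelCoeff_le _
  refine h1.trans ?_
  let g : (Fin d → Fin m → ZMod b) → (Fin d → Fin (m + 1)) := fun k j =>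
    ⟨level (k j), Nat.lt_succ_of_le (level_le _)⟩
  rw [← Finset.sum_fiberwise _ g, tailSum, Finset.mul_sum]
  refine Finset.sum_le_sum fun a _ => ?_
  have hval : ∀ k, g k = a → ∀ j, level (k j) = a j := by
    rintro k rfl j
    rfl
  have h2 : ∀ k ∈ ((dualNet C).erase 0).filter (fun k => g k = a),
      ∏ j, coeffBound b (level (k j)) = ∏ j, coeffBound b (a j) := by
    intro k hk
    exact Finset.prod_congr rfl fun j _ => by rw [hval k (Finset.mem_filter.1 hk).2 j]
  have hcb : ∀ j, 0 ≤ coeffBound b (a j) := fun j => by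
    rw [coeffBound_eq hb]
    exact mul_nonneg (tailWeight_nonneg hb _) (by positivity)
  rw [Finset.sum_congr rfl h2, Finset.sum_const, nsmul_eq_mul]
  split_ifs with hM
  · have h3 : (((dualNet C).erase 0).filter (fun k => g k = a)).card
        ≤ b ^ (∑ j, (a j : ℕ) - (m - t)) := by
      refine le_trans (Finset.card_le_card fun k hk => ?_)
        (card_dualNet_level_le hC (fun j => (a j : ℕ)) hM.le)
      rw [Finset.mem_filter] at hk ⊢
      exact ⟨Finset.mem_of_mem_erase hk.1, hval k hk.2⟩
    have h4 : ((((dualNet C).erase 0).filter (fun k => g k = a)).card : ℝ)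
        ≤ (b : ℝ) ^ (∑ j, (a j : ℕ) - (m - t)) := by exact_mod_cast h3
    refine (mul_le_mul_of_nonneg_right h4 (Finset.prod_nonneg fun j _ => hcb j)).trans (le_of_eq ?_)
    simp only [coeffBound_eq hb, Finset.prod_mul_distrib, Finset.prod_pow_eq_pow_sum]
    have h5 : (1 / (b : ℝ)) ^ (∑ j, (a j : ℕ))
        = (1 / (b : ℝ)) ^ (∑ j, (a j : ℕ) - (m - t)) * (1 / (b : ℝ)) ^ (m - t) := by
      rw [← pow_add]
      congr 1
      omega
    have h6 : (b : ℝ) ^ (∑ j, (a j : ℕ) - (m - t)) * (1 / (b : ℝ)) ^ (∑ j, (a j : ℕ) - (m - t)) = 1 := by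
      rw [← mul_pow, mul_one_div_cancel hb0, one_pow]
    rw [h5]
    linear_combination (∏ j, tailWeight b (a j)) * (1 / (b : ℝ)) ^ (m - t) * h6
  · have : ((dualNet C).erase 0).filter (fun k => g k = a) = ∅ := by
      refine Finset.filter_eq_empty_iff.2 fun k hk hg => hM ?_
      have := sum_level_gt_of_mem_dualNet hd hC (Finset.mem_of_mem_erase hk)
        (Finset.ne_of_mem_erase hk)
      simpa only [hval k hg] using this
    rw [this]
    simp

lemma shiftKernel_self (x : Fin m → ZMod b) :
    shiftKernel x x = 1 / 2 - 1 / (3 * (b : ℝ) ^ m) + 1 / (6 * ((b : ℝ) ^ m) ^ 2) := by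
  have hb0 : (b : ℝ) ≠ 0 := by exact_mod_cast NeZero.ne b
  simp only [shiftKernel, absMean, sqMean, if_true, sub_self, Finset.sum_const, Finset.card_univ,
    Fintype.card_fun, ZMod.card, Fintype.card_fin, nsmul_eq_mul]
  push_cast
  field_simp
  ring

/-- The averaged kernel at equal digits is (1 - ε)/2 with b^m ε ≤ 2/3. Bernoulli's inequality bounds
1 - (1 - ε)^d by dε, and d/2^d ≤ 1/2. -/
lemma diagonal_le (hb : 2 ≤ b) :
    (b : ℝ) ^ m * ((1 / 2) ^ d - (shiftKernel (0 : Fin m → ZMod b) 0) ^ d) ≤ 1 / 3 := by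
  rw [shiftKernel_self]
  have hB : (1 : ℝ) ≤ (b : ℝ) ^ m := one_le_pow₀ (by exact_mod_cast (by omega : 1 ≤ b))
  set B : ℝ := (b : ℝ) ^ m
  set ε : ℝ := 2 * (1 / (3 * B) - 1 / (6 * B ^ 2)) with hε
  have e1 : (1 : ℝ) / 2 - 1 / (3 * B) + 1 / (6 * B ^ 2) = 1 / 2 * (1 - ε) := by rw [hε]; ring
  have hB0 : 0 < B := by linarith
  have hε1 : B * ε ≤ 2 / 3 := by
    have : B * ε = 2 / 3 - 1 / (3 * B) := by rw [hε]; field_simp; ring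
    rw [this]
    have : 0 ≤ 1 / (3 * B) := by positivity
    linarith
  have hε2 : ε ≤ 1 := by
    nlinarith
  rw [e1, mul_pow]
  have h1 := one_add_mul_le_pow (a := -ε) (by linarith) d
  have h2 : (1 / 2 : ℝ) ^ d * (2 * d) ≤ 1 / 2 * 2 := by
    have : 2 * d ≤ 2 ^ d := by
      rcases d with _ | _ | d
      · simp
      · simp
      · have := Nat.lt_two_pow_self (n := d + 1)
        rw [pow_succ]
        omega
    have h3 : (2 * d : ℝ) ≤ 2 ^ d := by exact_mod_cast this
    rw [one_div, inv_pow, inv_mul_le_iff₀ (by positivity)]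
    linarith
  have h3 : (0 : ℝ) ≤ (1 / 2 : ℝ) ^ d := by positivity
  have h4 : (1 / 2 : ℝ) ^ d - (1 / 2) ^ d * (1 - ε) ^ d ≤ (1 / 2) ^ d * (d * ε) := by
    have : (1 / 2 : ℝ) ^ d * (1 + d * -ε) ≤ (1 / 2) ^ d * (1 - ε) ^ d := by
      rw [sub_eq_add_neg]
      exact mul_le_mul_of_nonneg_left h1 h3
    linarith
  have h5 : B * ((1 / 2 : ℝ) ^ d - (1 / 2) ^ d * (1 - ε) ^ d)
      ≤ (1 / 2 : ℝ) ^ d * (2 * d) * (B * ε / 2) := by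
    calc _ ≤ B * ((1 / 2) ^ d * (d * ε)) := mul_le_mul_of_nonneg_left h4 hB0.le
      _ = _ := by ring
  refine h5.trans ?_
  have h6 : (0 : ℝ) ≤ (1 / 2 : ℝ) ^ d * (2 * d) := by positivity
  calc (1 / 2 : ℝ) ^ d * (2 * d) * (B * ε / 2) ≤ (1 / 2 : ℝ) ^ d * (2 * d) * (1 / 3) :=
        mul_le_mul_of_nonneg_left (by linarith) h6
    _ ≤ 1 / 3 := by linarith

lemma meanSquare_le (hb : 2 ≤ b) (hd : 1 ≤ d) (htm : t < m ∨ d = 1)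
    {C : Fin d → Matrix (Fin m) (Fin m) (ZMod b)} (hC : IsGenerating b t m d C) :
    (b : ℝ) ^ m * (∑ v : Fin m → ZMod b, ∏ j, shiftKernel ((C j).mulVec v) 0
        + ((1 / 2) ^ d - (shiftKernel (0 : Fin m → ZMod b) 0) ^ d))
        - ((b : ℝ) ^ m) ^ 2 * (1 / 3) ^ d
      ≤ (b : ℝ) ^ (2 * t) * ((m : ℝ) - (t : ℝ)) ^ (d - 1) * ((1 + (b : ℝ) ^ 2) / 3) ^ d := by
  have hb0 : (b : ℝ) ≠ 0 := by positivity
  have h2 : (2 : ℝ) ≤ b := by exact_mod_cast hb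
  have ht : t ≤ m := hC.1
  have h1 := diagonal_le (m := m) (d := d) hb
  have hq : (5 / 3 : ℝ) ≤ (1 + (b : ℝ) ^ 2) / 3 := by nlinarith
  have hqd : (5 / 3 : ℝ) ≤ ((1 + (b : ℝ) ^ 2) / 3) ^ d :=
    hq.trans (le_self_pow₀ (by linarith) (by omega))
  have hbt : (1 : ℝ) ≤ (b : ℝ) ^ (2 * t) := one_le_pow₀ (by linarith)
  have hcast : ((m - t : ℕ) : ℝ) = (m : ℝ) - t := Nat.cast_sub ht
  -- For d = 1 the exponent is 0, so the power is 1 even when t = m.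
  have hMd : (1 : ℝ) ≤ ((m : ℝ) - (t : ℝ)) ^ (d - 1) := by
    rcases htm with h | h
    · refine one_le_pow₀ ?_
      rw [← hcast]
      exact_mod_cast (by omega : 1 ≤ m - t)
    · simp [h]
  have hT : tailSum b m d (m - t)
      ≤ 3 / 5 * ((1 + (b : ℝ) ^ 2) / 3) ^ d * (1 / (b : ℝ)) ^ (m - t)
        * ((m : ℝ) - (t : ℝ)) ^ (d - 1) := by
    obtain ⟨e, rfl⟩ : ∃ e, d = e + 1 := ⟨d - 1, by omega⟩
    rcases htm with h | h
    · rw [← hcast, Nat.add_sub_cancel]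
      exact tailSum_le hb m e (by omega)
    · obtain rfl : e = 0 := by omega
      simpa using tailSum_one_le hb m (m - t)
  have hS := sum_dualNet_le hb hd hC
  rw [sum_prod_shiftKernel]
  set S := ∑ k ∈ dualNet C, ∏ j, kernelCoeff (k j)
  set Q := ((1 + (b : ℝ) ^ 2) / 3) ^ d
  set R := ((m : ℝ) - (t : ℝ)) ^ (d - 1)
  have hx : ((b : ℝ) ^ m) ^ 2 * ((1 / (b : ℝ)) ^ (m - t) * (1 / (b : ℝ)) ^ (m - t))
      = (b : ℝ) ^ (2 * t) := by
    have : m = (m - t) + t := by omega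
    have e1 : (b : ℝ) ^ m = (b : ℝ) ^ (m - t) * b ^ t := by rw [← pow_add]; congr 1
    have e2 : (b : ℝ) ^ (m - t) * (1 / (b : ℝ)) ^ (m - t) = 1 := by
      rw [← mul_pow, mul_one_div_cancel hb0, one_pow]
    rw [e1, show 2 * t = t + t by ring, pow_add]
    linear_combination ((b : ℝ) ^ t) ^ 2
      * ((b : ℝ) ^ (m - t) * (1 / (b : ℝ)) ^ (m - t) + 1) * e2
  have hS' : S ≤ (1 / 3) ^ d + (1 / (b : ℝ)) ^ (m - t)
      * (3 / 5 * Q * (1 / (b : ℝ)) ^ (m - t) * R) :=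
    hS.trans (by gcongr)
  have h3 : ((b : ℝ) ^ m) ^ 2 * S ≤ ((b : ℝ) ^ m) ^ 2 * (1 / 3) ^ d
      + 3 / 5 * ((b : ℝ) ^ (2 * t) * R * Q) := by
    refine (mul_le_mul_of_nonneg_left hS' (by positivity)).trans (le_of_eq ?_)
    linear_combination (3 / 5 * Q * R) * hx
  -- The tail uses 3/5 of the bound; the remaining 2/5 is at least 2/3, more than the diagonal error
  -- 1/3.
  have h4 : 5 / 3 ≤ (b : ℝ) ^ (2 * t) * R * Q := by
    have h5 : 1 ≤ (b : ℝ) ^ (2 * t) * R := one_le_mul_of_one_le_of_one_le hbt hMd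
    nlinarith
  linarith

end Bound

/-! ### Integrals of coordinatewise products over pairs of vectors -/

section PiProd

variable {ι α β : Type*} [Fintype ι] [MeasurableSpace α] [MeasurableSpace β]

lemma integral_prod_pi (μ : ι → Measure α) (ν : ι → Measure β) [∀ i, SigmaFinite (μ i)]
    [∀ i, SigmaFinite (ν i)] (g : ι → α × β → ℝ) :
    ∫ z : (ι → α) × (ι → β), ∏ i, g i (z.1 i, z.2 i) ∂((Measure.pi μ).prod (Measure.pi ν))
      = ∏ i, ∫ w, g i w ∂((μ i).prod (ν i)) := by
  have h := measurePreserving_arrowProdEquivProdArrow α β ι μ ν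
  rw [← h.integral_comp' (fun z : (ι → α) × (ι → β) => ∏ i, g i (z.1 i, z.2 i)),
    ← integral_fintype_prod_eq_prod]
  rfl

lemma integrable_prod_pi (μ : ι → Measure α) (ν : ι → Measure β) [∀ i, SigmaFinite (μ i)]
    [∀ i, SigmaFinite (ν i)] {g : ι → α × β → ℝ}
    (hg : ∀ i, Integrable (g i) ((μ i).prod (ν i))) :
    Integrable (fun z : (ι → α) × (ι → β) => ∏ i, g i (z.1 i, z.2 i))
      ((Measure.pi μ).prod (Measure.pi ν)) := by
  have h := measurePreserving_arrowProdEquivProdArrow α β ι μ ν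
  rw [← h.integrable_comp_emb (MeasurableEquiv.measurableEmbedding _)]
  exact Integrable.fintype_prod (f := g) hg

end PiProd

/-! ### Piecewise quadratic integrals -/

section Quadratic

/-- The integral of `A + B y + C y ^ 2` from `a` to `c`. -/
noncomputable def quadIntegral (A B C a c : ℝ) : ℝ :=
  A * (c - a) + B * ((c ^ 2 - a ^ 2) / 2) + C * ((c ^ 3 - a ^ 3) / 3)

/-- Agreement on the open interval suffices since endpoints are null; the half-open conventions of
the periodic intervals therefore play no role. -/
lemma integral_quad_on_Ioo {F : ℝ → ℝ} {a c A B C : ℝ} (hac : a ≤ c)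
    (h : ∀ y ∈ Set.Ioo a c, F y = A + B * y + C * y ^ 2) :
    IntervalIntegrable F volume a c ∧ ∫ y in a..c, F y = quadIntegral A B C a c := by
  have hcont : Continuous fun y : ℝ => A + B * y + C * y ^ 2 := by fun_prop
  constructor
  · rw [intervalIntegrable_iff_integrableOn_Ioo_of_le hac]
    refine (IntegrableOn.congr_fun ?_ (fun y hy => (h y hy).symm) measurableSet_Ioo)
    rw [← intervalIntegrable_iff_integrableOn_Ioo_of_le hac]
    exact hcont.intervalIntegrable _ _
  · rw [intervalIntegral.integral_of_le hac, integral_Ioc_eq_integral_Ioo,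
      setIntegral_congr_fun measurableSet_Ioo h, ← integral_Ioc_eq_integral_Ioo,
      ← intervalIntegral.integral_of_le hac, intervalIntegral.integral_add,
      intervalIntegral.integral_add, intervalIntegral.integral_const_mul,
      intervalIntegral.integral_const_mul, intervalIntegral.integral_const, integral_id,
      integral_pow, quadIntegral, smul_eq_mul]
    · norm_num
      ring
    all_goals exact Continuous.intervalIntegrable (by fun_prop) _ _

lemma integral_quad_three {F : ℝ → ℝ} {a c : ℝ} (h0 : 0 ≤ a) (hac : a ≤ c) (h1 : c ≤ 1)
    (A B C A' B' C' A'' B'' C'' : ℝ)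
    (hF : ∀ y ∈ Set.Ioo 0 a, F y = A + B * y + C * y ^ 2)
    (hF' : ∀ y ∈ Set.Ioo a c, F y = A' + B' * y + C' * y ^ 2)
    (hF'' : ∀ y ∈ Set.Ioo c 1, F y = A'' + B'' * y + C'' * y ^ 2) :
    ∫ y in Set.Icc 0 1, F y = quadIntegral A B C 0 a + quadIntegral A' B' C' a c
      + quadIntegral A'' B'' C'' c 1 := by
  obtain ⟨i1, e1⟩ := integral_quad_on_Ioo h0 hF
  obtain ⟨i2, e2⟩ := integral_quad_on_Ioo hac hF'
  obtain ⟨i3, e3⟩ := integral_quad_on_Ioo h1 hF''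
  rw [integral_Icc_eq_integral_Ioc, ← intervalIntegral.integral_of_le zero_le_one,
    ← intervalIntegral.integral_add_adjacent_intervals (i1.trans i2) i3,
    ← intervalIntegral.integral_add_adjacent_intervals i1 i2, e1, e2, e3]

end Quadratic

/-! ### One-dimensional kernel of the periodic discrepancy -/

section OneDim

/-- The indicator of `q ∈ I(x, y)`. -/
noncomputable def perInd (q : ℝ) (z : ℝ × ℝ) : ℝ :=
  if z.1 ≤ z.2 then (if z.1 ≤ q ∧ q < z.2 then 1 else 0)
    else (if (0 ≤ q ∧ q < z.2) ∨ (z.1 ≤ q ∧ q < 1) then 1 else 0)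

/-- The length of `I(x, y)`. -/
noncomputable def perLen (z : ℝ × ℝ) : ℝ :=
  if z.1 ≤ z.2 then z.2 - z.1 else 1 + z.2 - z.1

lemma perInd_eq (q x y : ℝ) [Decidable (q ∈ perInterval x y)] :
    perInd q (x, y) = if q ∈ perInterval x y then 1 else 0 := by
  unfold perInd perInterval
  by_cases h : x ≤ y <;> simp [h]

lemma volume_real_perInterval {x y : ℝ} (hx : x ∈ Set.Icc (0 : ℝ) 1) (hy : y ∈ Set.Icc (0 : ℝ) 1) :
    volume.real (perInterval x y) = perLen (x, y) := by
  unfold perInterval perLen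
  split_ifs with h
  · rw [Real.volume_real_Ico_of_le h]
  · have h' : y < x := not_le.1 h
    have hdisj : Disjoint (Set.Ico 0 y) (Set.Ico x 1) := by
      rw [Set.disjoint_left]
      intro z hz hz'
      exact absurd (hz.2.trans h') (not_lt.2 hz'.1)
    rw [measureReal_union hdisj measurableSet_Ico measure_Ico_lt_top.ne measure_Ico_lt_top.ne,
      Real.volume_real_Ico_of_le hy.1, Real.volume_real_Ico_of_le hx.2]
    simp only []
    ring

lemma measurable_perInd (q : ℝ) : Measurable (perInd q) := by
  unfold perInd
  refine Measurable.ite (measurableSet_le measurable_fst measurable_snd) ?_ ?_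
  · refine Measurable.ite ?_ measurable_const measurable_const
    exact (measurableSet_le measurable_fst measurable_const).inter
      (measurableSet_lt measurable_const measurable_snd)
  · refine Measurable.ite ?_ measurable_const measurable_const
    refine MeasurableSet.union ?_ ?_
    · exact (MeasurableSet.const _).inter (measurableSet_lt measurable_const measurable_snd)
    · exact (measurableSet_le measurable_fst measurable_const).inter (MeasurableSet.const _)

lemma measurable_perLen : Measurable perLen :=
  Measurable.ite (measurableSet_le measurable_fst measurable_snd) (by fun_prop) (by fun_prop)

lemma abs_perInd_le (q : ℝ) (z : ℝ × ℝ) : |perInd q z| ≤ 1 := by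
  unfold perInd
  split_ifs <;> simp

/-- Lebesgue measure on the unit interval. -/
noncomputable abbrev unitMeasure : Measure ℝ := volume.restrict (Set.Icc 0 1)

lemma ae_abs_perLen_le : ∀ᵐ z ∂(unitMeasure.prod unitMeasure), |perLen z| ≤ 1 := by
  rw [Measure.prod_restrict]
  refine (ae_restrict_mem (measurableSet_Icc.prod measurableSet_Icc)).mono ?_
  rintro ⟨x, y⟩ ⟨⟨h1, h2⟩, h3, h4⟩
  unfold perLen
  simp only at *
  rw [abs_le]
  split_ifs <;> constructor <;> linarith

lemma integrable_perInd_mul (p q : ℝ) :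
    Integrable (fun z => perInd p z * perInd q z) (unitMeasure.prod unitMeasure) := by
  refine Integrable.of_bound
    ((measurable_perInd p).mul (measurable_perInd q)).aestronglyMeasurable 1 (.of_forall fun z => ?_)
  rw [Real.norm_eq_abs, abs_mul]
  exact mul_le_one₀ (abs_perInd_le p z) (abs_nonneg _) (abs_perInd_le q z)

lemma integrable_perInd_mul_perLen (q : ℝ) :
    Integrable (fun z => perInd q z * perLen z) (unitMeasure.prod unitMeasure) := by
  refine Integrable.of_bound
    ((measurable_perInd q).mul measurable_perLen).aestronglyMeasurable 1 ?_
  filter_upwards [ae_abs_perLen_le] with z hz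
  rw [Real.norm_eq_abs, abs_mul]
  exact mul_le_one₀ (abs_perInd_le q z) (abs_nonneg _) hz

lemma integrable_perLen_sq :
    Integrable (fun z => perLen z ^ 2) (unitMeasure.prod unitMeasure) := by
  refine Integrable.of_bound (measurable_perLen.pow_const 2).aestronglyMeasurable 1 ?_
  filter_upwards [ae_abs_perLen_le] with z hz
  rw [Real.norm_eq_abs, abs_pow]
  exact pow_le_one₀ (abs_nonneg _) hz

lemma perInd_eq_one {q x y : ℝ} (h1 : x ≤ q) (h2 : q < y) : perInd q (x, y) = 1 := by
  simp [perInd, h1, h2, (h1.trans h2.le)]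

lemma perInd_eq_one_of_lt_right {q x y : ℝ} (h : y < x) (h0 : 0 ≤ q) (h1 : q < y) :
    perInd q (x, y) = 1 := by
  simp [perInd, not_le.2 h, h0, h1]

lemma perInd_eq_one_of_le_left {q x y : ℝ} (h : y < x) (h0 : x ≤ q) (h1 : q < 1) :
    perInd q (x, y) = 1 := by
  simp [perInd, not_le.2 h, h0, h1]

lemma perInd_eq_zero_of_lt {q x y : ℝ} (h : x ≤ y) (h0 : q < x) : perInd q (x, y) = 0 := by
  simp [perInd, h, not_le.2 h0]

lemma perInd_eq_zero_of_ge {q x y : ℝ} (h : x ≤ y) (h0 : y ≤ q) : perInd q (x, y) = 0 := by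
  simp [perInd, h, not_lt.2 h0]

lemma perInd_eq_zero {q x y : ℝ} (h0 : y ≤ q) (h1 : q < x) : perInd q (x, y) = 0 := by
  simp [perInd, not_le.2 (h0.trans_lt h1), not_lt.2 h0, not_le.2 h1]

lemma perLen_of_le {x y : ℝ} (h : x ≤ y) : perLen (x, y) = y - x := if_pos h

lemma perLen_of_lt {x y : ℝ} (h : y < x) : perLen (x, y) = 1 + y - x := if_neg (not_le.2 h)

/-- The reproducing kernel of the periodic `L₂` discrepancy. -/
noncomputable def perKernel (u : ℝ) : ℝ := 1 / 2 - |u| + u ^ 2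

lemma integral_perInd_mul_of_le {p q : ℝ} (hp : 0 ≤ p) (hpq : p ≤ q) (hq : q < 1) :
    ∫ z, perInd p z * perInd q z ∂(unitMeasure.prod unitMeasure) = perKernel (p - q) := by
  rw [integral_prod _ (integrable_perInd_mul p q)]
  -- For x < p both points are captured when y < x or y > q; for p < x < q, when p < y < x; for x >
  -- q, when q < y < x.
  have i1 : ∀ x ∈ Set.Ioo 0 p, ∫ y in Set.Icc 0 1, perInd p (x, y) * perInd q (x, y)
      = (1 - q) + 1 * x + 0 * x ^ 2 := by
    rintro x ⟨h1, h2⟩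
    rw [integral_quad_three h1.le (h2.le.trans hpq) hq.le 1 0 0 0 0 0 1 0 0]
    · simp only [quadIntegral]; ring
    · rintro y ⟨h3, h4⟩
      rw [perInd_eq_one_of_le_left h4 h2.le (by linarith),
        perInd_eq_one_of_le_left h4 (by linarith) hq]
      ring
    · rintro y ⟨h3, h4⟩
      rw [perInd_eq_zero_of_ge (q := q) h3.le h4.le]
      ring
    · rintro y ⟨h3, h4⟩
      rw [perInd_eq_one h2.le (by linarith), perInd_eq_one (by linarith) h3]
      ring
  have i2 : ∀ x ∈ Set.Ioo p q, ∫ y in Set.Icc 0 1, perInd p (x, y) * perInd q (x, y)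
      = -p + 1 * x + 0 * x ^ 2 := by
    rintro x ⟨h1, h2⟩
    rw [integral_quad_three hp h1.le (h2.trans hq).le 0 0 0 1 0 0 0 0 0]
    · simp only [quadIntegral]; ring
    · rintro y ⟨h3, h4⟩
      rw [perInd_eq_zero h4.le h1]
      ring
    · rintro y ⟨h3, h4⟩
      rw [perInd_eq_one_of_lt_right h4 hp h3, perInd_eq_one_of_le_left h4 h2.le hq]
      ring
    · rintro y ⟨h3, h4⟩
      rw [perInd_eq_zero_of_lt h3.le h1]
      ring
  have i3 : ∀ x ∈ Set.Ioo q 1, ∫ y in Set.Icc 0 1, perInd p (x, y) * perInd q (x, y)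
      = -q + 1 * x + 0 * x ^ 2 := by
    rintro x ⟨h1, h2⟩
    rw [integral_quad_three (hp.trans hpq) h1.le h2.le 0 0 0 1 0 0 0 0 0]
    · simp only [quadIntegral]; ring
    · rintro y ⟨h3, h4⟩
      rw [perInd_eq_zero (q := q) h4.le h1]
      ring
    · rintro y ⟨h3, h4⟩
      rw [perInd_eq_one_of_lt_right h4 hp (by linarith),
        perInd_eq_one_of_lt_right h4 (by linarith) h3]
      ring
    · rintro y ⟨h3, h4⟩
      rw [perInd_eq_zero_of_lt (q := q) h3.le h1]
      ring
  rw [integral_quad_three hp hpq hq.le _ _ _ _ _ _ _ _ _ i1 i2 i3, perKernel,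
    abs_of_nonpos (by linarith)]
  simp only [quadIntegral]
  ring

lemma integral_perInd_mul {p q : ℝ} (hp : p ∈ Set.Ico (0 : ℝ) 1) (hq : q ∈ Set.Ico (0 : ℝ) 1) :
    ∫ z, perInd p z * perInd q z ∂(unitMeasure.prod unitMeasure) = perKernel (p - q) := by
  rcases le_total p q with h | h
  · exact integral_perInd_mul_of_le hp.1 h hq.2
  · have := integral_perInd_mul_of_le hq.1 h hp.2
    rw [perKernel, abs_sub_comm, sub_sq_comm] at this
    rw [perKernel, ← this]
    exact integral_congr_ae (.of_forall fun z => mul_comm _ _)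

lemma integral_perInd_mul_perLen {q : ℝ} (hq : q ∈ Set.Ico (0 : ℝ) 1) :
    ∫ z, perInd q z * perLen z ∂(unitMeasure.prod unitMeasure) = 1 / 3 := by
  rw [integral_prod _ (integrable_perInd_mul_perLen q)]
  obtain ⟨hq0, hq1⟩ := hq
  have i1 : ∀ x ∈ Set.Ioo 0 q, ∫ y in Set.Icc 0 1, perInd q (x, y) * perLen (x, y)
      = (1 - q ^ 2) / 2 + q * x + (-1 / 2) * x ^ 2 := by
    rintro x ⟨h1, h2⟩
    rw [integral_quad_three h1.le h2.le hq1.le (1 - x) 1 0 0 0 0 (-x) 1 0]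
    · simp only [quadIntegral]; ring
    · rintro y ⟨h3, h4⟩
      rw [perInd_eq_one_of_le_left h4 h2.le hq1, perLen_of_lt h4]
      ring
    · rintro y ⟨h3, h4⟩
      rw [perInd_eq_zero_of_ge h3.le h4.le]
      ring
    · rintro y ⟨h3, h4⟩
      rw [perInd_eq_one h2.le h3, perLen_of_le (by linarith)]
      ring
  have i3 : ∀ x ∈ Set.Ioo q 1, ∫ y in Set.Icc 0 1, perInd q (x, y) * perLen (x, y)
      = (-q - q ^ 2 / 2) + (1 + q) * x + (-1 / 2) * x ^ 2 := by
    rintro x ⟨h1, h2⟩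
    rw [integral_quad_three hq0 h1.le h2.le 0 0 0 (1 - x) 1 0 0 0 0]
    · simp only [quadIntegral]; ring
    · rintro y ⟨h3, h4⟩
      rw [perInd_eq_zero h4.le h1]
      ring
    · rintro y ⟨h3, h4⟩
      rw [perInd_eq_one_of_lt_right h4 hq0 h3, perLen_of_lt h4]
      ring
    · rintro y ⟨h3, h4⟩
      rw [perInd_eq_zero_of_lt h3.le h1]
      ring
  rw [integral_quad_three hq0 le_rfl hq1.le _ _ _ 0 0 0 _ _ _ i1
    (fun y hy => absurd (hy.1.trans hy.2) (lt_irrefl _)) i3]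
  simp only [quadIntegral]
  ring

/-- For fixed x the length is y - x modulo 1, hence uniform on the unit interval as y varies. -/
lemma integral_perLen_sq :
    ∫ z, perLen z ^ 2 ∂(unitMeasure.prod unitMeasure) = 1 / 3 := by
  rw [integral_prod _ integrable_perLen_sq]
  have i1 : ∀ x ∈ Set.Ioo (0 : ℝ) 1, ∫ y in Set.Icc 0 1, perLen (x, y) ^ 2
      = 1 / 3 + 0 * x + 0 * x ^ 2 := by
    rintro x ⟨h1, h2⟩
    rw [integral_quad_three h1.le le_rfl h2.le ((1 - x) ^ 2) (2 * (1 - x)) 1 0 0 0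
      (x ^ 2) (-2 * x) 1]
    · simp only [quadIntegral]; ring
    · rintro y ⟨h3, h4⟩
      rw [perLen_of_lt h4]
      ring
    · exact fun y hy => absurd (hy.1.trans hy.2) (lt_irrefl _)
    · rintro y ⟨h3, h4⟩
      rw [perLen_of_le h3.le]
      ring
  rw [integral_quad_three zero_le_one le_rfl le_rfl _ _ _ 0 0 0 0 0 0 i1
    (fun y hy => absurd (hy.1.trans hy.2) (lt_irrefl _))
    (fun y hy => absurd (hy.1.trans hy.2) (lt_irrefl _))]
  simp only [quadIntegral]
  ring

end OneDim

/-! ### Closed formula for the squared periodic discrepancy -/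

section Warnock

variable {N d : ℕ}

lemma localDiscrepancy_perBox (P : Fin N → Fin d → ℝ) {x y : Fin d → ℝ}
    (hx : x ∈ Set.Icc (0 : Fin d → ℝ) 1) (hy : y ∈ Set.Icc (0 : Fin d → ℝ) 1) :
    localDiscrepancy P (perBox x y)
      = ∑ n, ∏ j, perInd (P n j) (x j, y j) - N * ∏ j, perLen (x j, y j) := by
  classical
  unfold localDiscrepancy
  congr 1
  · rw [count, Set.ncard_eq_toFinset_card', Set.toFinset_ofPred, ← Finset.sum_boole]
    refine Finset.sum_congr rfl fun n _ => ?_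
    simp only [perInd_eq, Finset.prod_ite_zero, Finset.prod_const_one, perBox, Set.mem_univ_pi,
      Finset.mem_univ, forall_true_left]
  · rw [Measure.real, perBox, volume_pi_pi, ENNReal.toReal_prod]
    congr 1
    exact Finset.prod_congr rfl fun j _ =>
      volume_real_perInterval ⟨hx.1 j, hx.2 j⟩ ⟨hy.1 j, hy.2 j⟩

lemma restrict_Icc_eq_pi :
    (volume : Measure (Fin d → ℝ)).restrict (Set.Icc 0 1) = Measure.pi fun _ => unitMeasure := by
  rw [← Set.pi_univ_Icc, volume_pi, Measure.restrict_pi_pi]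
  rfl

lemma sq_sub_eq_sum (f : Fin N → ℝ) (c g : ℝ) :
    (∑ n, f n - c * g) ^ 2
      = ∑ n, ∑ p, f n * f p - 2 * c * ∑ n, f n * g + c ^ 2 * g ^ 2 := by
  rw [← Finset.sum_mul_sum, ← Finset.sum_mul]
  ring

/-- All three parts of the expanded square factor over coordinates. Each of the N cross integrals
and the squared volume integrate to 3^(-d), so they combine to (-2N² + N²)/3^d. -/
theorem perLpDiscrepancy_two_sq (P : Fin N → Fin d → ℝ) (hP : ∀ n j, P n j ∈ Set.Ico (0 : ℝ) 1) :
    perLpDiscrepancy 2 P ^ 2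
      = ∑ n, ∑ p, ∏ j, perKernel (P n j - P p j) - (N : ℝ) ^ 2 * (1 / 3) ^ d := by
  have h0 : 0 ≤ ∫ x in Set.Icc (0 : Fin d → ℝ) 1, ∫ y in Set.Icc (0 : Fin d → ℝ) 1,
      |localDiscrepancy P (perBox x y)| ^ (2 : ℝ) :=
    integral_nonneg fun x => integral_nonneg fun y => by positivity
  rw [perLpDiscrepancy, ← Real.sqrt_eq_rpow, Real.sq_sqrt h0]
  have h1 : ∀ x ∈ Set.Icc (0 : Fin d → ℝ) 1, ∫ y in Set.Icc (0 : Fin d → ℝ) 1,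
      |localDiscrepancy P (perBox x y)| ^ (2 : ℝ)
      = ∫ y in Set.Icc (0 : Fin d → ℝ) 1,
        (∑ n, ∑ p, ∏ j, (perInd (P n j) (x j, y j) * perInd (P p j) (x j, y j))
          - 2 * N * ∑ n, ∏ j, (perInd (P n j) (x j, y j) * perLen (x j, y j))
          + (N : ℝ) ^ 2 * ∏ j, perLen (x j, y j) ^ 2) := by
    intro x hx
    refine setIntegral_congr_fun measurableSet_Icc fun y hy => ?_
    simp only [Real.rpow_two, sq_abs]
    rw [localDiscrepancy_perBox P hx hy, sq_sub_eq_sum]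
    simp only [Finset.prod_mul_distrib, Finset.prod_pow]
  rw [setIntegral_congr_fun measurableSet_Icc h1, restrict_Icc_eq_pi]
  have I1 : ∀ n p, Integrable (fun z : (Fin d → ℝ) × (Fin d → ℝ) =>
      ∏ j, (perInd (P n j) (z.1 j, z.2 j) * perInd (P p j) (z.1 j, z.2 j)))
      ((Measure.pi fun _ => unitMeasure).prod (Measure.pi fun _ => unitMeasure)) := fun n p =>
    integrable_prod_pi (fun _ => unitMeasure) (fun _ => unitMeasure)
      fun j => integrable_perInd_mul (P n j) (P p j)
  have I2 : ∀ n, Integrable (fun z : (Fin d → ℝ) × (Fin d → ℝ) =>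
      ∏ j, (perInd (P n j) (z.1 j, z.2 j) * perLen (z.1 j, z.2 j)))
      ((Measure.pi fun _ => unitMeasure).prod (Measure.pi fun _ => unitMeasure)) := fun n =>
    integrable_prod_pi (fun _ => unitMeasure) (fun _ => unitMeasure)
      fun j => integrable_perInd_mul_perLen (P n j)
  have I3 : Integrable (fun z : (Fin d → ℝ) × (Fin d → ℝ) =>
      ∏ j, perLen (z.1 j, z.2 j) ^ 2)
      ((Measure.pi fun _ => unitMeasure).prod (Measure.pi fun _ => unitMeasure)) :=
    integrable_prod_pi (fun _ => unitMeasure) (fun _ => unitMeasure) fun _ => integrable_perLen_sq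
  have J1 := integrable_finsetSum Finset.univ fun n _ =>
    integrable_finsetSum Finset.univ fun p _ => I1 n p
  have J2 := (integrable_finsetSum Finset.univ fun n _ => I2 n).const_mul (2 * (N : ℝ))
  have J3 := I3.const_mul ((N : ℝ) ^ 2)
  rw [integral_integral ((J1.sub J2).add J3)]
  have e := integral_add (J1.sub J2) J3
  have e' := integral_sub J1 J2
  simp only [Pi.sub_apply] at e e'
  rw [e, e', integral_const_mul, integral_const_mul,
    integral_finsetSum _ fun n _ => integrable_finsetSum _ fun p _ => I1 n p,
    integral_finsetSum _ fun n _ => I2 n,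
    integral_prod_pi (fun _ => unitMeasure) (fun _ => unitMeasure) fun _ z => perLen z ^ 2]
  have e1 : ∀ n, ∫ z : (Fin d → ℝ) × (Fin d → ℝ),
      ∏ j, (perInd (P n j) (z.1 j, z.2 j) * perLen (z.1 j, z.2 j))
      ∂((Measure.pi fun _ => unitMeasure).prod (Measure.pi fun _ => unitMeasure)) = (1 / 3) ^ d := by
    intro n
    rw [integral_prod_pi (fun _ => unitMeasure) (fun _ => unitMeasure)
      fun j z => perInd (P n j) z * perLen z]
    simp [integral_perInd_mul_perLen (hP n _)]
  have e2 : ∀ n, ∫ z : (Fin d → ℝ) × (Fin d → ℝ),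
      ∑ p, ∏ j, (perInd (P n j) (z.1 j, z.2 j) * perInd (P p j) (z.1 j, z.2 j))
      ∂((Measure.pi fun _ => unitMeasure).prod (Measure.pi fun _ => unitMeasure))
      = ∑ p, ∏ j, perKernel (P n j - P p j) := by
    intro n
    rw [integral_finsetSum _ fun p _ => I1 n p]
    refine Finset.sum_congr rfl fun p _ => ?_
    rw [integral_prod_pi (fun _ => unitMeasure) (fun _ => unitMeasure)
      fun j z => perInd (P n j) z * perInd (P p j) z]
    exact Finset.prod_congr rfl fun j _ => integral_perInd_mul (hP n j) (hP p j)
  simp only [e1, e2, integral_perLen_sq, Finset.sum_const, Finset.card_univ, Fintype.card_fin,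
    Finset.prod_const, nsmul_eq_mul]
  ring

end Warnock

/-! ### Indices and digit vectors -/

section DigitVec

variable {b m : ℕ}

lemma digitVec_succ (n : ℕ) : digitVec b (m + 1) n = Fin.cons (n : ZMod b) (digitVec b m (n / b)) := by
  funext i
  refine Fin.cases ?_ (fun i => ?_) i
  · simp [digitVec]
  · simp [digitVec, pow_succ', Nat.div_div_eq_div_mul]

lemma digitVec_injective {n p : ℕ} (hn : n < b ^ m) (hp : p < b ^ m)
    (h : digitVec b m n = digitVec b m p) : n = p := by
  induction m generalizing n p with
  | zero => simp at hn hp; omega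
  | succ m ih =>
    rw [digitVec_succ, digitVec_succ, Fin.cons_inj] at h
    have h1 := ih (Nat.div_lt_of_lt_mul (by rwa [← pow_succ']))
      (Nat.div_lt_of_lt_mul (by rwa [← pow_succ'])) h.2
    have h2 := (ZMod.natCast_eq_natCast_iff' _ _ _).1 h.1
    rw [← Nat.div_add_mod n b, ← Nat.div_add_mod p b, h1, h2]

lemma digitVec_bijective [NeZero b] : Function.Bijective fun n : Fin (b ^ m) => digitVec b m n := by
  rw [Fintype.bijective_iff_injective_and_card]
  refine ⟨fun n p h => Fin.ext (digitVec_injective n.2 p.2 h), ?_⟩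
  simp [ZMod.card]

end DigitVec

/-! ### Joint law of two rows of a random array -/

section Marginals

variable {ι Ω : Type*} [Fintype ι] [MeasurableSpace Ω]

lemma measurePreserving_eval_pair (W : Measure Ω) [IsProbabilityMeasure W] {n p : ι} (h : n ≠ p) :
    MeasurePreserving (fun δ : ι → Ω => (δ n, δ p)) (Measure.pi fun _ => W) (W.prod W) := by
  refine ⟨by fun_prop, ?_⟩
  have hind := (iIndepFun_pi (μ := fun _ : ι => W) (X := fun _ (ω : Ω) => ω)
    (fun _ => aemeasurable_id)).indepFun h
  rw [indepFun_iff_map_prod_eq_prod_map_map (measurable_pi_apply n).aemeasurable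
    (measurable_pi_apply p).aemeasurable] at hind
  rw [hind]
  exact congrArg₂ _ (measurePreserving_eval (fun _ : ι => W) n).map_eq
    (measurePreserving_eval (fun _ : ι => W) p).map_eq

lemma measurePreserving_pairs {κ : Type*} [Fintype κ] (V : Measure Ω) [IsProbabilityMeasure V]
    {n p : ι} (h : n ≠ p) :
    MeasurePreserving (fun (δ : ι → κ → Ω) (j : κ) => (δ n j, δ p j))
      (Measure.pi fun _ => Measure.pi fun _ => V) (Measure.pi fun _ => V.prod V) :=
  (measurePreserving_arrowProdEquivProdArrow Ω Ω κ (fun _ => V) (fun _ => V)).symm.comp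
    (measurePreserving_eval_pair (Measure.pi fun _ : κ => V) h)

end Marginals

/-! ### Averaging the kernel over two uniform perturbations -/

section UniformLaw

/-- The uniform distribution on `[0, ε)`. -/
noncomputable abbrev uniformIco (ε : ℝ) : Measure ℝ := ProbabilityTheory.cond volume (Set.Ico (0 : ℝ) ε)

variable {ε : ℝ}

lemma isProbabilityMeasure_uniformIco (hε : 0 < ε) : IsProbabilityMeasure (uniformIco ε) := by
  apply cond_isProbabilityMeasure_of_finite
  · simpa using hε
  · exact measure_Ico_lt_top.ne

lemma ae_mem_uniformIco : ∀ᵐ u ∂(uniformIco ε), u ∈ Set.Ico (0 : ℝ) ε := by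
  rw [uniformIco, ProbabilityTheory.cond]
  exact Measure.ae_smul_measure (ae_restrict_mem measurableSet_Ico) _

lemma integral_uniformIco (hε : 0 < ε) (f : ℝ → ℝ) :
    ∫ u, f u ∂(uniformIco ε) = ε⁻¹ * ∫ u in (0 : ℝ)..ε, f u := by
  rw [uniformIco, ProbabilityTheory.cond, integral_smul_measure, Real.volume_Ico, sub_zero, ENNReal.toReal_inv,
    ENNReal.toReal_ofReal hε.le, intervalIntegral.integral_of_le hε.le,
    integral_Ico_eq_integral_Ioo, integral_Ioc_eq_integral_Ioo, smul_eq_mul]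

lemma abs_perKernel_le {u : ℝ} (hu : |u| ≤ 2) : |perKernel u| ≤ 7 := by
  have h := abs_nonneg u
  have h2 : u ^ 2 ≤ 4 := by
    rw [← sq_abs]
    nlinarith
  rw [perKernel, abs_le]
  constructor <;> nlinarith [sq_nonneg u]

lemma continuous_perKernel : Continuous perKernel := by
  unfold perKernel
  fun_prop

/-- Since |D| ≥ ε, the sign s of D is also that of D + u - v, so the perturbation drops out of the
mean distance; in the mean square it adds its variance ε²/6. -/
lemma integral_perKernel_of_le {D : ℝ} (hε : 0 < ε) (hD : ε ≤ |D|) :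
    ∫ u, ∫ v, perKernel (D + u - v) ∂(uniformIco ε) ∂(uniformIco ε)
      = 1 / 2 - |D| + (D ^ 2 + ε ^ 2 / 6) := by
  obtain ⟨s, hs, hsD, hs1⟩ : ∃ s : ℝ, |D| = s * D ∧
      (∀ u ∈ Set.Ioo 0 ε, ∀ v ∈ Set.Ioo 0 ε, |D + u - v| = s * (D + u - v)) ∧ s ^ 2 = 1 := by
    rcases le_total 0 D with h | h
    · rw [abs_of_nonneg h] at hD ⊢
      refine ⟨1, by ring, fun u hu v hv => ?_, by norm_num⟩
      rw [abs_of_nonneg (by linarith [hu.1, hv.2]), one_mul]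
    · rw [abs_of_nonpos h] at hD ⊢
      refine ⟨-1, by ring, fun u hu v hv => ?_, by norm_num⟩
      rw [abs_of_nonpos (by linarith [hu.2, hv.1])]
      ring
  simp only [integral_uniformIco hε]
  have h1 : ∀ u ∈ Set.Ioo 0 ε, ε⁻¹ * ∫ v in (0 : ℝ)..ε, perKernel (D + u - v)
      = (1 / 2 - s * D + D ^ 2 + s * ε / 2 - D * ε + ε ^ 2 / 3) + (-s + 2 * D - ε) * u
        + 1 * u ^ 2 := by
    intro u hu
    rw [(integral_quad_on_Ioo hε.le (A := 1 / 2 - s * (D + u) + (D + u) ^ 2)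
      (B := s - 2 * (D + u)) (C := 1) (fun v hv => by
        rw [perKernel, hsD u hu v hv]
        ring)).2, quadIntegral]
    field_simp
    ring
  rw [(integral_quad_on_Ioo hε.le h1).2, quadIntegral, hs]
  field_simp
  ring

lemma integral_perKernel_zero (hε : 0 < ε) :
    ∫ u, ∫ v, perKernel (u - v) ∂(uniformIco ε) ∂(uniformIco ε)
      = 1 / 2 - ε / 3 + ε ^ 2 / 6 := by
  simp only [integral_uniformIco hε]
  have h1 : ∀ u ∈ Set.Ioo 0 ε, ε⁻¹ * ∫ v in (0 : ℝ)..ε, perKernel (u - v)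
      = (1 / 2 - ε / 2 + ε ^ 2 / 3) + (1 - ε) * u + (1 - 1 / ε) * u ^ 2 := by
    intro u hu
    obtain ⟨i1, e1⟩ := integral_quad_on_Ioo (F := fun v => perKernel (u - v)) hu.1.le
      (A := 1 / 2 - u + u ^ 2) (B := 1 - 2 * u) (C := 1) (fun v hv => by
        rw [perKernel, abs_of_nonneg (by linarith [hv.2])]
        ring)
    obtain ⟨i2, e2⟩ := integral_quad_on_Ioo (F := fun v => perKernel (u - v)) hu.2.le
      (A := 1 / 2 + u + u ^ 2) (B := -1 - 2 * u) (C := 1) (fun v hv => by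
        rw [perKernel, abs_of_nonpos (by linarith [hv.1])]
        ring)
    rw [← intervalIntegral.integral_add_adjacent_intervals i1 i2, e1, e2, quadIntegral,
      quadIntegral]
    field_simp
    ring
  rw [(integral_quad_on_Ioo hε.le h1).2, quadIntegral]
  field_simp
  ring

end UniformLaw

/-! ### Expectation under the random digital shift -/

section Expectation

variable {b m d N : ℕ} [NeZero b]

/-- The uniform distribution on digit vectors. -/
noncomputable abbrev digitLaw (b m : ℕ) : Measure (Fin m → ZMod b) :=
  Measure.pi fun _ => uniformOn Set.univ

instance : IsProbabilityMeasure (uniformOn (Set.univ : Set (ZMod b))) :=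
  isProbabilityMeasure_uniformOn Set.finite_univ Set.univ_nonempty

lemma integral_digitLaw (f : (Fin m → ZMod b) → ℝ) :
    ∫ s, f s ∂(digitLaw b m) = ((b : ℝ) ^ m)⁻¹ * ∑ s, f s := by
  rw [integral_fintype .of_finite, Finset.mul_sum]
  refine Finset.sum_congr rfl fun s _ => ?_
  rw [smul_eq_mul, Measure.real, Measure.pi_singleton, ENNReal.toReal_prod]
  congr 1
  have : ∀ x : ZMod b, (uniformOn (Set.univ : Set (ZMod b)) {x}).toReal = (b : ℝ)⁻¹ := by
    intro x
    rw [uniformOn_univ]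
    simp [ZMod.card]
  simp [this]

/-- The kernel between two shifted points with digits `x` and `y`. -/
noncomputable def shiftedPair (x y : Fin m → ZMod b) (w : (Fin m → ZMod b) × (ℝ × ℝ)) : ℝ :=
  perKernel (ofDigits (x + w.1) + w.2.1 - (ofDigits (y + w.1) + w.2.2))

lemma measurable_shiftedPair (x y : Fin m → ZMod b) : Measurable (shiftedPair x y) := by
  unfold shiftedPair
  refine continuous_perKernel.measurable.comp ?_
  have h1 : Measurable fun s : Fin m → ZMod b => ofDigits (x + s) := Measurable.of_discrete
  have h2 : Measurable fun s : Fin m → ZMod b => ofDigits (y + s) := Measurable.of_discrete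
  exact ((h1.comp measurable_fst).add (measurable_fst.comp measurable_snd)).sub
    ((h2.comp measurable_fst).add (measurable_snd.comp measurable_snd))

lemma pow_inv_pos (b m : ℕ) [NeZero b] : 0 < 1 / (b : ℝ) ^ m := by
  have hb : (0 : ℝ) < b := by exact_mod_cast Nat.pos_of_ne_zero (NeZero.ne b)
  positivity

instance : IsProbabilityMeasure (uniformIco (1 / (b : ℝ) ^ m)) :=
  isProbabilityMeasure_uniformIco (pow_inv_pos b m)

lemma ofDigits_add_mem {u : ℝ} (y : Fin m → ZMod b) (hu : u ∈ Set.Ico (0 : ℝ) (1 / (b : ℝ) ^ m)) :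
    ofDigits y + u ∈ Set.Ico (0 : ℝ) 1 :=
  ⟨add_nonneg (ofDigits_nonneg y) hu.1, by linarith [ofDigits_add_le y, hu.2]⟩

lemma integrable_shiftedPair (x y : Fin m → ZMod b) :
    Integrable (shiftedPair x y) ((digitLaw b m).prod
      ((uniformIco (1 / (b : ℝ) ^ m)).prod (uniformIco (1 / (b : ℝ) ^ m)))) := by
  refine Integrable.of_bound (measurable_shiftedPair x y).aestronglyMeasurable 7 ?_
  have h1 := Measure.quasiMeasurePreserving_snd (μ := digitLaw b m) |>.ae
    ((Measure.quasiMeasurePreserving_fst (ν := uniformIco (1 / (b : ℝ) ^ m))).ae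
      (ae_mem_uniformIco (ε := 1 / (b : ℝ) ^ m)))
  have h2 := Measure.quasiMeasurePreserving_snd (μ := digitLaw b m) |>.ae
    ((Measure.quasiMeasurePreserving_snd (μ := uniformIco (1 / (b : ℝ) ^ m))).ae
      (ae_mem_uniformIco (ε := 1 / (b : ℝ) ^ m)))
  filter_upwards [h1, h2] with w hw1 hw2
  have e1 := ofDigits_add_mem (x + w.1) hw1
  have e2 := ofDigits_add_mem (y + w.1) hw2
  refine abs_perKernel_le ?_
  rw [abs_le]
  constructor <;> linarith [e1.1, e1.2, e2.1, e2.2]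

/-- A common shift keeps distinct digit vectors distinct, hence at least b^(-m) apart, so the
perturbations cannot reverse their order. For equal digit vectors only the two perturbations remain.
-/
lemma integral_shiftedPair (x y : Fin m → ZMod b) :
    ∫ w, shiftedPair x y w ∂((digitLaw b m).prod
      ((uniformIco (1 / (b : ℝ) ^ m)).prod (uniformIco (1 / (b : ℝ) ^ m)))) = shiftKernel x y := by
  have hε := pow_inv_pos b m
  have hb : (b : ℝ) ≠ 0 := by exact_mod_cast NeZero.ne b
  rw [integral_prod _ (integrable_shiftedPair x y), integral_digitLaw]
  have key : ∀ s : Fin m → ZMod b, ∫ w, shiftedPair x y (s, w)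
      ∂((uniformIco (1 / (b : ℝ) ^ m)).prod (uniformIco (1 / (b : ℝ) ^ m)))
      = 1 / 2 - (if x = y then 1 / (3 * (b : ℝ) ^ m) else |ofDigits (x + s) - ofDigits (y + s)|)
        + ((ofDigits (x + s) - ofDigits (y + s)) ^ 2 + 1 / (6 * ((b : ℝ) ^ m) ^ 2)) := by
    intro s
    have hint : Integrable (fun w => shiftedPair x y (s, w))
        ((uniformIco (1 / (b : ℝ) ^ m)).prod (uniformIco (1 / (b : ℝ) ^ m))) := by
      refine Integrable.of_bound
        ((measurable_shiftedPair x y).comp measurable_prodMk_left).aestronglyMeasurable 7 ?_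
      filter_upwards [(Measure.quasiMeasurePreserving_fst (ν := uniformIco (1 / (b : ℝ) ^ m))).ae
        (ae_mem_uniformIco (ε := 1 / (b : ℝ) ^ m)),
        (Measure.quasiMeasurePreserving_snd (μ := uniformIco (1 / (b : ℝ) ^ m))).ae
        (ae_mem_uniformIco (ε := 1 / (b : ℝ) ^ m))] with w hw1 hw2
      have e1 := ofDigits_add_mem (x + s) hw1
      have e2 := ofDigits_add_mem (y + s) hw2
      refine abs_perKernel_le ?_
      rw [abs_le]
      constructor <;> linarith [e1.1, e1.2, e2.1, e2.2]
    rw [integral_prod _ hint]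
    have e : ∀ u v : ℝ, shiftedPair x y (s, (u, v))
        = perKernel ((ofDigits (x + s) - ofDigits (y + s)) + u - v) := by
      intro u v
      rw [shiftedPair]
      congr 1
      ring
    simp only [e]
    split_ifs with h
    · subst h
      simp only [sub_self, zero_add]
      rw [integral_perKernel_zero hε]
      field_simp
      ring
    · rw [integral_perKernel_of_le hε (ofDigits_sub_abs_ge fun he => h (add_right_cancel he))]
      field_simp
  simp only [key, Finset.sum_add_distrib, Finset.sum_sub_distrib, shiftKernel, absMean, sqMean,
    Finset.sum_const, Finset.card_univ, Fintype.card_fun, ZMod.card, Fintype.card_fin, nsmul_eq_mul]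
  push_cast
  field_simp

lemma ae_mem_shiftLaw :
    ∀ᵐ s ∂(shiftLaw b m d N), ∀ n j, s.2 n j ∈ Set.Ico (0 : ℝ) (1 / (b : ℝ) ^ m) := by
  rw [ae_all_iff]
  intro n
  rw [ae_all_iff]
  intro j
  have h : ∀ᵐ δ ∂(Measure.pi fun _ : Fin N => Measure.pi fun _ : Fin d =>
      uniformIco (1 / (b : ℝ) ^ m)), δ n j ∈ Set.Ico (0 : ℝ) (1 / (b : ℝ) ^ m) := by
    have h1 : ∀ᵐ v ∂(Measure.pi fun _ : Fin d => uniformIco (1 / (b : ℝ) ^ m)),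
        v j ∈ Set.Ico (0 : ℝ) (1 / (b : ℝ) ^ m) :=
      (measurePreserving_eval (fun _ : Fin d =>
        uniformIco (1 / (b : ℝ) ^ m)) j).quasiMeasurePreserving.ae ae_mem_uniformIco
    exact (measurePreserving_eval (fun _ : Fin N => Measure.pi fun _ : Fin d =>
      uniformIco (1 / (b : ℝ) ^ m)) n).quasiMeasurePreserving.ae h1
  exact Measure.quasiMeasurePreserving_snd.ae h

instance : IsProbabilityMeasure (shiftLaw b m d N) := by
  unfold shiftLaw
  infer_instance

/-- For n ≠ p the two rows of perturbations are independent, so the law regroups into a product over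
coordinates, with one digit shift and two perturbations in each. -/
lemma integral_shiftLaw_pair {n p : Fin N} (hnp : n ≠ p) (x y : Fin d → Fin m → ZMod b) :
    Integrable (fun s : (Fin d → Fin m → ZMod b) × (Fin N → Fin d → ℝ) =>
        ∏ j, perKernel (ofDigits (x j + s.1 j) + s.2 n j - (ofDigits (y j + s.1 j) + s.2 p j)))
        (shiftLaw b m d N) ∧
      ∫ s, ∏ j, perKernel (ofDigits (x j + s.1 j) + s.2 n j - (ofDigits (y j + s.1 j) + s.2 p j))
        ∂(shiftLaw b m d N) = ∏ j, shiftKernel (x j) (y j) := by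
  have hpres := (MeasurePreserving.id (Measure.pi fun _ : Fin d => digitLaw b m)).prod
    (measurePreserving_pairs (κ := Fin d) (uniformIco (1 / (b : ℝ) ^ m)) hnp)
  have hint := integrable_prod_pi (fun _ : Fin d => digitLaw b m)
    (fun _ : Fin d => (uniformIco (1 / (b : ℝ) ^ m)).prod (uniformIco (1 / (b : ℝ) ^ m)))
    fun j => integrable_shiftedPair (x j) (y j)
  refine ⟨hpres.integrable_comp_of_integrable hint, ?_⟩
  simp only [← integral_shiftedPair]
  rw [← integral_prod_pi (fun _ : Fin d => digitLaw b m)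
    (fun _ : Fin d => (uniformIco (1 / (b : ℝ) ^ m)).prod (uniformIco (1 / (b : ℝ) ^ m)))
    fun j => shiftedPair (x j) (y j)]
  have := integral_map hpres.measurable.aemeasurable
    (by rw [hpres.map_eq]; exact hint.aestronglyMeasurable)
  rw [hpres.map_eq] at this
  exact this.symm

theorem integral_perLpDiscrepancy_digitalShift (P : Fin N → Fin d → ℝ) :
    Integrable (fun s => perLpDiscrepancy 2 (digitalShift s.1 s.2 P) ^ 2) (shiftLaw b m d N) ∧
      ∫ s, perLpDiscrepancy 2 (digitalShift s.1 s.2 P) ^ 2 ∂(shiftLaw b m d N)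
        = ∑ n, ∑ p, (if n = p then (1 / 2) ^ d else
            ∏ j, shiftKernel (expansion b m (P n j)) (expansion b m (P p j)))
          - (N : ℝ) ^ 2 * (1 / 3) ^ d := by
  -- The closed formula needs the shifted points in the unit cube, which holds almost surely;
  -- integrability is transferred along this identity. The diagonal is kept apart because a point
  -- has difference exactly 0 with itself.
  have hae : (fun s : (Fin d → Fin m → ZMod b) × (Fin N → Fin d → ℝ) =>
      ∑ n, ∑ p, (if n = p then (1 / 2 : ℝ) ^ d else
        ∏ j, perKernel (ofDigits (expansion b m (P n j) + s.1 j) + s.2 n j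
          - (ofDigits (expansion b m (P p j) + s.1 j) + s.2 p j))) - (N : ℝ) ^ 2 * (1 / 3) ^ d)
      =ᵐ[shiftLaw b m d N] fun s => perLpDiscrepancy 2 (digitalShift s.1 s.2 P) ^ 2 := by
    filter_upwards [ae_mem_shiftLaw] with s hs
    rw [perLpDiscrepancy_two_sq (digitalShift s.1 s.2 P)
      fun n j => ofDigits_add_mem (expansion b m (P n j) + s.1 j) (hs n j)]
    congr 1
    refine Finset.sum_congr rfl fun n _ => Finset.sum_congr rfl fun p _ => ?_
    split_ifs with h
    · subst h
      simp [perKernel]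
    · rfl
  have hI : ∀ n p, Integrable (fun s : (Fin d → Fin m → ZMod b) × (Fin N → Fin d → ℝ) =>
      if n = p then (1 / 2 : ℝ) ^ d else
        ∏ j, perKernel (ofDigits (expansion b m (P n j) + s.1 j) + s.2 n j
          - (ofDigits (expansion b m (P p j) + s.1 j) + s.2 p j))) (shiftLaw b m d N) := by
    intro n p
    split_ifs with h
    · exact integrable_const _
    · exact (integral_shiftLaw_pair h _ _).1
  have hS := integrable_finsetSum Finset.univ fun n _ =>
    integrable_finsetSum Finset.univ fun p _ => hI n p
  refine ⟨(hS.sub (integrable_const _)).congr hae, ?_⟩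
  rw [← integral_congr_ae hae, integral_sub hS (integrable_const _),
    integral_finsetSum _ fun n _ => integrable_finsetSum _ fun p _ => hI n p]
  congr 1
  · refine Finset.sum_congr rfl fun n _ => ?_
    rw [integral_finsetSum _ fun p _ => hI n p]
    refine Finset.sum_congr rfl fun p _ => ?_
    split_ifs with h
    · simp
    · exact (integral_shiftLaw_pair h (fun j => expansion b m (P n j))
        (fun j => expansion b m (P p j))).2
  · simp

/-- By linearity the kernel depends on n and p through the difference of their digit vectors, and
for fixed n that difference runs once through all vectors. The correction replaces the averaged
kernel by K(0) on the diagonal. -/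
lemma sum_shiftKernel_netPoint (C : Fin d → Matrix (Fin m) (Fin m) (ZMod b)) :
    ∑ n : Fin (b ^ m), ∑ p : Fin (b ^ m), (if n = p then (1 / 2 : ℝ) ^ d else
        ∏ j, shiftKernel (expansion b m (netPoint C n j)) (expansion b m (netPoint C p j)))
      = (b : ℝ) ^ m * (∑ v : Fin m → ZMod b, ∏ j, shiftKernel ((C j).mulVec v) 0
        + ((1 / 2) ^ d - (shiftKernel (0 : Fin m → ZMod b) 0) ^ d)) := by
  let e : Fin (b ^ m) ≃ (Fin m → ZMod b) := Equiv.ofBijective _ digitVec_bijective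
  have h1 : ∀ n p : Fin (b ^ m), (if n = p then (1 / 2 : ℝ) ^ d else
        ∏ j, shiftKernel (expansion b m (netPoint C n j)) (expansion b m (netPoint C p j)))
      = ∏ j, shiftKernel ((C j).mulVec (e n - e p)) 0
        + if n = p then (1 / 2) ^ d - (shiftKernel (0 : Fin m → ZMod b) 0) ^ d else 0 := by
    intro n p
    split_ifs with h
    · subst h
      simp
    · rw [add_zero]
      refine Finset.prod_congr rfl fun j _ => ?_
      rw [netPoint, netPoint, expansion_ofDigits, expansion_ofDigits, shiftKernel_sub,
        Matrix.mulVec_sub]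
      rfl
  simp only [h1, Finset.sum_add_distrib, Finset.sum_ite_eq, Finset.mem_univ, if_true]
  have h2 : ∀ n : Fin (b ^ m), ∑ p : Fin (b ^ m), ∏ j, shiftKernel ((C j).mulVec (e n - e p)) 0
      = ∑ v : Fin m → ZMod b, ∏ j, shiftKernel ((C j).mulVec v) 0 := fun n =>
    Fintype.sum_equiv (e.trans (Equiv.subLeft (e n))) _ _ fun p => rfl
  simp only [h2, Finset.sum_const, Finset.card_univ, Fintype.card_fin, nsmul_eq_mul]
  push_cast
  ring

end Expectation

end PeriodicDiscrepancy

theorem mainTheorem2 (b : ℕ) (hb : b.Prime) (t m d : ℕ) (hm : 1 ≤ m) (hd : 1 ≤ d)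
    (htm : t < m ∨ d = 1) (P : Fin (b ^ m) → Fin d → ℝ)
    (hP : PeriodicDiscrepancy.IsDigitalNet b t m d P) :
    MeasureTheory.Integrable
        (fun s : (Fin d → Fin m → ZMod b) × (Fin (b ^ m) → Fin d → ℝ) =>
          PeriodicDiscrepancy.perLpDiscrepancy 2
            (PeriodicDiscrepancy.digitalShift s.1 s.2 P) ^ 2)
        (PeriodicDiscrepancy.shiftLaw b m d (b ^ m)) ∧
      ∫ s, PeriodicDiscrepancy.perLpDiscrepancy 2
            (PeriodicDiscrepancy.digitalShift s.1 s.2 P) ^ 2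
          ∂(PeriodicDiscrepancy.shiftLaw b m d (b ^ m)) ≤
        (b : ℝ) ^ (2 * t) * ((m : ℝ) - (t : ℝ)) ^ (d - 1) * ((1 + (b : ℝ) ^ 2) / 3) ^ d := by
  have : NeZero b := ⟨hb.ne_zero⟩
  obtain ⟨C, hC, rfl⟩ := hP
  obtain ⟨hint, heq⟩ := PeriodicDiscrepancy.integral_perLpDiscrepancy_digitalShift
    (b := b) (m := m) (PeriodicDiscrepancy.netPoint C)
  refine ⟨hint, ?_⟩
  rw [heq, PeriodicDiscrepancy.sum_shiftKernel_netPoint, Nat.cast_pow]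
  exact PeriodicDiscrepancy.meanSquare_le hb.two_le hd htm hC
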